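/- Let $0<\alpha<1$, let $\sigma_\alpha(n)=\sum_{d\mid n}d^{\alpha}$ for positive integers $n$, and for real $x\ge 1$ define $E_\alpha(x)$ by $$\sum_{n\le x}\sigma_\alpha(n)=\frac{x^{1+\alpha}}{1+\alpha}\,\zeta(1+\alpha)+x\,\zeta(1-\alpha)+E_\alpha(x),$$ where $\zeta$ is the (analytically continued) Riemann zeta function. Then, as $x\to+\infty$ through the reals, $$\sup_{n\le x}\sigma_\alpha(n)=x^{\alpha}\exp\left(\left(\frac1{1-\alpha}+o(1)\right)\frac{(\ln x)^{1-\alpha}}{\ln\ln x}\right),$$ the supremum being over positive integers $n\le x$, and $$E_\alpha(x)=\Omega\left(x^{\alpha}\exp\left(\left(\frac1{1-\alpha}+o(1)\right)\frac{(\ln x)^{1-\alpha}}{\ln\ln x}\right)\right).$$ More explicitly, there is a function $\eta$ with $\eta(x)\to0$ as $x\to+\infty$ such that, writing $$G(x)=x^{\alpha}\exp\left(\left(\frac1{1-\alpha}+\eta(x)\right)\frac{(\ln x)^{1-\alpha}}{\ln\ln x}\right),$$ one has $\sup_{n\le x}\sigma_\alpha(n)=G(x)$ for all sufficiently large $x$,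 and $E_\alpha(x)=\Omega(G(x))$ with the same $\eta$, i.e. there is a constant $c>0$ such that $|E_\alpha(x)|\ge c\,G(x)$ for arbitrarily large real $x$. -/

import Mathlib

open Filter Topology

noncomputable section

/-- The fractional divisor function `σ_α(n) = ∑_{d ∣ n} d ^ α`, for real `α`. -/
def fracSigma (α : ℝ) (n : ℕ) : ℝ :=
  ∑ d ∈ n.divisors, (d : ℝ) ^ α

/-- The values `σ_α(n)` at the positive integers `n ≤ x`. -/
def fracSigmaValues (α x : ℝ) : Set ℝ :=
  {y | ∃ n : ℕ, 1 ≤ n ∧ (n : ℝ) ≤ x ∧ y = fracSigma α n}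

/-- The error term `E_α(x)` defined by
`∑_{n ≤ x} σ_α(n) = x ^ (1 + α) / (1 + α) * ζ(1 + α) + x * ζ(1 - α) + E_α(x)`.
The zeta function is Mathlib's (analytically continued) one; its values at real arguments
are real, and `re` only moves them from `ℂ` to `ℝ`. -/
def sigmaError (α x : ℝ) : ℝ :=
  (∑ n ∈ Finset.Icc 1 ⌊x⌋₊, fracSigma α n)
    - (x ^ (1 + α) / (1 + α) * (riemannZeta ((1 + α : ℝ) : ℂ)).re
        + x * (riemannZeta ((1 - α : ℝ) : ℂ)).re)

/-- `f(x) = Ω(g(x))` as `x → +∞`: for some `c > 0`, `|f(x)| ≥ c |g(x)|` holds for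
arbitrarily large real `x`. -/
def IsOmega (f g : ℝ → ℝ) : Prop :=
  ∃ c : ℝ, 0 < c ∧ ∃ᶠ x in atTop, c * |g x| ≤ |f x|

/-- `x ^ α * exp ((1 / (1 - α) + η) * (ln x) ^ (1 - α) / ln ln x)`; the `o(1)` of the result
is put in for `η`. -/
def sigmaMaxOrder (α η x : ℝ) : ℝ :=
  x ^ α * Real.exp ((1 / (1 - α) + η) * (Real.log x ^ (1 - α) / Real.log (Real.log x)))

end

/-! Since `σ_α(n) = n^α ∑_{d ∣ n} d^(-α)`, the size of the supremum is decided by the divisor sum.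
Its logarithm is at most about `∑_{p ∣ n} p^(-α)`, up to a factor `1 + ε` and a bounded term, with a
matching lower bound for squarefree numbers. The constraint is `∑_{p ∣ n} log p ≤ L`, where `L = log
x`, so the best choice is to use all primes up to about `L`. This gives `∑_{p ≤ L} p^(-α) ~ L^(1-α)
/ ((1-α) log L)`. The upper bound is a Lagrange multiplier argument
(`sum_primeFactors_rpow_neg_le`); the lower bound uses a multiple of a primorial
(`exists_fracSigma_ge`).

The sharp constant needs the prime number theorem `θ(x) ~ x`. It comes from a Tauberian theorem with
Fejér kernels (`tendsto_one_of_laplace_continuousOn`), fed by the continuity of `-ζ'/ζ - 1/(s-1)` up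
to `Re s = 1`. Partial summation then gives `tendsto_sum_primes_rpow`.

For the Ω-result, let `n` be a record value of `σ_α`. The error term jumps by `σ_α(n)` at `n` while
the main term is continuous, so the error is at least `σ_α(n) / 4` at `n` or just to its left, and
there the supremum is at most `σ_α(n)`. -/

/-! ### The Fejér kernel and its Fourier representation -/

open MeasureTheory Set Complex in
lemma integral_one_sub_abs_mul_exp (v : ℝ) :
    ∫ ξ in (-1 : ℝ)..1, ((1 - |ξ| : ℝ) : ℂ) * Complex.exp (Complex.I * ξ * v) =
      ((Real.sinc (v / 2) ^ 2 : ℝ) : ℂ) := by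
  have hcont : Continuous fun ξ : ℝ => ((1 - |ξ| : ℝ) : ℂ) * Complex.exp (Complex.I * ξ * v) := by
    fun_prop
  rw [← intervalIntegral.integral_add_adjacent_intervals (b := 0)
    (hcont.intervalIntegrable _ _) (hcont.intervalIntegrable _ _)]
  have e1 : ∫ ξ in (-1 : ℝ)..0, ((1 - |ξ| : ℝ) : ℂ) * Complex.exp (Complex.I * ξ * v) =
      ∫ ξ in (-1 : ℝ)..0, (1 + ξ : ℂ) * Complex.exp (Complex.I * ξ * v) := by
    refine intervalIntegral.integral_congr fun ξ hξ => ?_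
    rw [uIcc_of_le (by norm_num)] at hξ
    simp [abs_of_nonpos hξ.2]
  have e2 : ∫ ξ in (0 : ℝ)..1, ((1 - |ξ| : ℝ) : ℂ) * Complex.exp (Complex.I * ξ * v) =
      ∫ ξ in (0 : ℝ)..1, (1 - ξ : ℂ) * Complex.exp (Complex.I * ξ * v) := by
    refine intervalIntegral.integral_congr fun ξ hξ => ?_
    rw [uIcc_of_le (by norm_num)] at hξ
    simp [abs_of_nonneg hξ.1]
  rw [e1, e2]
  rcases eq_or_ne v 0 with rfl | hv
  · have h1 : ∫ ξ in (-1 : ℝ)..0, (1 + ξ : ℂ) * Complex.exp (Complex.I * ξ * (0 : ℝ)) =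
        ((∫ ξ in (-1 : ℝ)..0, (1 + ξ) : ℝ) : ℂ) := by
      rw [← intervalIntegral.integral_ofReal]; simp
    have h2 : ∫ ξ in (0 : ℝ)..1, (1 - ξ : ℂ) * Complex.exp (Complex.I * ξ * (0 : ℝ)) =
        ((∫ ξ in (0 : ℝ)..1, (1 - ξ) : ℝ) : ℂ) := by
      rw [← intervalIntegral.integral_ofReal]; simp
    rw [h1, h2, intervalIntegral.integral_add (by simp) (by simp),
      intervalIntegral.integral_sub (by simp) (by simp)]
    norm_num
  · have hc : Complex.I * v ≠ 0 := by simp [hv]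
    have hv' : (v : ℂ) ≠ 0 := by simpa using hv
    have hE (ξ : ℝ) : HasDerivAt (fun ξ : ℝ => Complex.exp (Complex.I * ξ * v))
        (Complex.exp (Complex.I * ξ * v) * (Complex.I * v)) ξ := by
      have : HasDerivAt (fun ξ : ℝ => Complex.I * ξ * v) (Complex.I * v) ξ := by
        simpa using (((hasDerivAt_id (ξ : ℂ)).comp_ofReal).const_mul Complex.I).mul_const (v : ℂ)
      exact this.cexp
    have hI (ξ : ℝ) : HasDerivAt (fun ξ : ℝ => (ξ : ℂ)) 1 ξ := (hasDerivAt_id (ξ : ℂ)).comp_ofReal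
    have i1 : ∫ ξ in (-1 : ℝ)..0, (1 + ξ : ℂ) * Complex.exp (Complex.I * ξ * v) = _ :=
      intervalIntegral.integral_eq_sub_of_hasDerivAt
        (f := fun ξ : ℝ => (1 + ξ : ℂ) * Complex.exp (Complex.I * ξ * v) / (Complex.I * v)
          - Complex.exp (Complex.I * ξ * v) / (Complex.I * v) ^ 2)
        (fun ξ _ => by
          refine (((((hI ξ).const_add (1 : ℂ)).mul (hE ξ)).div_const (Complex.I * v)).sub
            ((hE ξ).div_const ((Complex.I * v) ^ 2))).congr_deriv ?_
          field_simp
          ring) (Continuous.intervalIntegrable (by fun_prop) _ _)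
    have i2 : ∫ ξ in (0 : ℝ)..1, (1 - ξ : ℂ) * Complex.exp (Complex.I * ξ * v) = _ :=
      intervalIntegral.integral_eq_sub_of_hasDerivAt
        (f := fun ξ : ℝ => (1 - ξ : ℂ) * Complex.exp (Complex.I * ξ * v) / (Complex.I * v)
          + Complex.exp (Complex.I * ξ * v) / (Complex.I * v) ^ 2)
        (fun ξ _ => by
          refine (((((hI ξ).const_sub (1 : ℂ)).mul (hE ξ)).div_const (Complex.I * v)).add
            ((hE ξ).div_const ((Complex.I * v) ^ 2))).congr_deriv ?_
          field_simp
          ring) (Continuous.intervalIntegrable (by fun_prop) _ _)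
    rw [i1, i2, Real.sinc_of_ne_zero (by simp [hv])]
    have hcos : Complex.sin (v / 2) ^ 2 =
        (2 - Complex.exp (Complex.I * v) - Complex.exp (-(Complex.I * v))) / 4 := by
      have h1 : Real.sin (v / 2) ^ 2 = (1 - Real.cos v) / 2 := by
        have := Real.cos_sq' (v / 2)
        have h2 := Real.cos_two_mul (v / 2)
        rw [mul_div_cancel₀ _ (two_ne_zero)] at h2
        linarith
      rw [← Complex.ofReal_ofNat, ← Complex.ofReal_div, ← Complex.ofReal_sin,
        ← Complex.ofReal_pow, h1]
      push_cast
      rw [Complex.cos, mul_comm Complex.I, neg_mul]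
      ring
    push_cast
    rw [div_pow, hcos]
    have hI2 : (Complex.I * v) ^ 2 = - (v : ℂ) ^ 2 := by rw [mul_pow, Complex.I_sq]; ring
    rw [hI2]
    simp only [mul_zero, zero_mul, Complex.exp_zero, mul_neg, mul_one, neg_mul]
    field_simp
    ring

/-- The constant is `1 + 4`: `sinc² ≤ 1`, and `v² sinc(v/2)² = 4 sin(v/2)² ≤ 4`. -/
lemma sinc_half_sq_le (v : ℝ) : Real.sinc (v / 2) ^ 2 ≤ 5 * (1 + v ^ 2)⁻¹ := by
  rw [← div_eq_mul_inv, le_div_iff₀ (by positivity)]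
  have h1 : Real.sinc (v / 2) ^ 2 ≤ 1 := by
    rw [sq_le_one_iff_abs_le_one]; exact Real.abs_sinc_le_one _
  have h2 : Real.sinc (v / 2) ^ 2 * v ^ 2 ≤ 4 := by
    rcases eq_or_ne v 0 with rfl | hv
    · simp
    · rw [Real.sinc_of_ne_zero (by simp [hv]), div_pow]
      have := Real.sin_sq_le_one (v / 2)
      field_simp
      linarith
  linarith

lemma integrable_sinc_half_sq : MeasureTheory.Integrable fun v : ℝ => Real.sinc (v / 2) ^ 2 := by
  refine (integrable_inv_one_add_sq.const_mul 5).mono'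
    (by fun_prop : Continuous fun v : ℝ => Real.sinc (v / 2) ^ 2).aestronglyMeasurable
    (.of_forall fun v => ?_)
  rw [Real.norm_of_nonneg (by positivity)]
  exact sinc_half_sq_le v

/-! ### Fejér means and the Laplace transform -/

-- Writing the kernel as the Fourier transform of a triangle and applying Fubini moves the mean onto
-- a segment of the line `Re z = σ`. The damping by `σ > 0` supplies the absolute convergence.
open MeasureTheory Set Complex in
lemma integral_mul_exp_mul_sinc_half_sq {h : ℝ → ℝ} (hm : Measurable h) {C : ℝ}
    (hC : ∀ t, |h t| ≤ C) {F : ℂ → ℂ}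
    (hF : ∀ z : ℂ, 0 < z.re → F z = ∫ t in Ioi (0 : ℝ), (h t : ℂ) * exp (-z * t))
    (l y : ℝ) {σ : ℝ} (hσ : 0 < σ) :
    ((∫ t in Ioi (0 : ℝ), h t * Real.exp (-σ * t) * Real.sinc (l * (y - t) / 2) ^ 2 : ℝ) : ℂ) =
      ∫ ξ in (-1 : ℝ)..1, ((1 - |ξ| : ℝ) : ℂ) * exp (I * ξ * (l * y)) * F (σ + I * (l * ξ)) := by
  have h1 (t : ℝ) : ((h t * Real.exp (-σ * t) * Real.sinc (l * (y - t) / 2) ^ 2 : ℝ) : ℂ) =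
      ∫ ξ in (-1 : ℝ)..1, ((h t * Real.exp (-σ * t) : ℝ) : ℂ) *
        (((1 - |ξ| : ℝ) : ℂ) * exp (I * ξ * (l * (y - t) : ℝ))) := by
    rw [intervalIntegral.integral_const_mul, integral_one_sub_abs_mul_exp]
    push_cast; ring
  rw [← integral_complex_ofReal]
  simp_rw [h1, intervalIntegral.integral_of_le (show (-1 : ℝ) ≤ 1 by norm_num)]
  have hint1 : Integrable (fun t : ℝ => ((h t * Real.exp (-σ * t) : ℝ) : ℂ))
      (volume.restrict (Ioi 0)) := by
    refine Integrable.ofReal ?_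
    exact (exp_neg_integrableOn_Ioi 0 hσ).bdd_mul (c := C) hm.aestronglyMeasurable (.of_forall hC)
  have hint2 : Integrable (fun ξ : ℝ => ((1 - |ξ| : ℝ) : ℂ)) (volume.restrict (Ioc (-1) 1)) :=
    (Continuous.integrableOn_Icc (by fun_prop)).mono_set Ioc_subset_Icc_self
  rw [integral_integral_swap]
  · refine integral_congr_ae (.of_forall fun ξ => ?_)
    simp only
    rw [hF _ (by simpa using hσ), ← integral_const_mul]
    refine integral_congr_ae (.of_forall fun t => ?_)
    simp only
    push_cast
    have : exp (I * ξ * (l * (y - t))) = exp (I * ξ * (l * y)) * exp (-(I * (l * ξ)) * t) := by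
      rw [← exp_add]; ring_nf
    rw [this, neg_add, add_mul, exp_add]
    ring
  · have := (hint1.mul_prod hint2).mul_bdd (c := 1)
      (g := fun p : ℝ × ℝ => exp (I * p.2 * (l * (y - p.1) : ℝ)))
      (Continuous.aestronglyMeasurable (by fun_prop)) (.of_forall fun p => le_of_eq <| by
        rw [show I * (p.2 : ℂ) * ((l * (y - p.1) : ℝ) : ℂ) = ((p.2 * (l * (y - p.1)) : ℝ) : ℂ) * I by
          push_cast; ring, norm_exp_ofReal_mul_I])
    refine this.congr (.of_forall fun p => ?_)
    simp [Function.uncurry, mul_assoc]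

-- This is the limit `σ → 0+` of the previous identity, by dominated convergence on both sides: the
-- integrable kernel dominates on the left, and a bound for `F` on a compact rectangle on the right.
open MeasureTheory Set Complex in
lemma integral_mul_sinc_half_sq {h : ℝ → ℝ} (hm : Measurable h) {C : ℝ}
    (hC : ∀ t, |h t| ≤ C) {F : ℂ → ℂ} (hFc : ContinuousOn F {z | 0 ≤ z.re})
    (hF : ∀ z : ℂ, 0 < z.re → F z = ∫ t in Ioi (0 : ℝ), (h t : ℂ) * exp (-z * t))
    {l : ℝ} (hl : 0 < l) (y : ℝ) :
    ((∫ t in Ioi (0 : ℝ), h t * Real.sinc (l * (y - t) / 2) ^ 2 : ℝ) : ℂ) =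
      ∫ ξ in (-1 : ℝ)..1, ((1 - |ξ| : ℝ) : ℂ) * exp (I * ξ * (l * y)) * F (I * (l * ξ)) := by
  have hint : Integrable fun t : ℝ => Real.sinc (l * (y - t) / 2) ^ 2 := by
    have := (integrable_sinc_half_sq.comp_mul_left' hl.ne').comp_sub_left y
    exact this
  have hleft : Tendsto (fun σ : ℝ => ((∫ t in Ioi (0 : ℝ), h t * Real.exp (-σ * t) *
      Real.sinc (l * (y - t) / 2) ^ 2 : ℝ) : ℂ)) (𝓝[>] 0)
      (𝓝 ((∫ t in Ioi (0 : ℝ), h t * Real.sinc (l * (y - t) / 2) ^ 2 : ℝ) : ℂ)) := by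
    refine (continuous_ofReal.tendsto _).comp ?_
    refine tendsto_integral_filter_of_dominated_convergence
      (fun t => C * Real.sinc (l * (y - t) / 2) ^ 2) (.of_forall fun σ => ?_) ?_
      (hint.const_mul C).integrableOn (.of_forall fun t => ?_)
    · exact (Measurable.aestronglyMeasurable (by fun_prop))
    · filter_upwards [self_mem_nhdsWithin] with σ hσ
      refine (ae_restrict_iff' measurableSet_Ioi).mpr (.of_forall fun t ht => ?_)
      rw [norm_mul, norm_mul, Real.norm_of_nonneg (sq_nonneg (Real.sinc _))]
      refine mul_le_mul_of_nonneg_right ?_ (sq_nonneg _)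
      have : ‖Real.exp (-σ * t)‖ ≤ 1 := by
        rw [Real.norm_of_nonneg (Real.exp_pos _).le, Real.exp_le_one_iff]
        have := mul_pos (mem_Ioi.mp hσ) (mem_Ioi.mp ht)
        linarith
      calc ‖h t‖ * ‖Real.exp (-σ * t)‖ ≤ C * 1 :=
            mul_le_mul (hC t) this (norm_nonneg _) ((abs_nonneg _).trans (hC t))
        _ = C := mul_one C
    · refine Tendsto.mono_left ?_ nhdsWithin_le_nhds
      have : Continuous fun σ : ℝ => h t * Real.exp (-σ * t) * Real.sinc (l * (y - t) / 2) ^ 2 := by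
        fun_prop
      simpa using this.tendsto 0
  have hK : IsCompact ((fun p : ℝ × ℝ => (p.1 + I * (l * p.2) : ℂ)) '' (Icc 0 1 ×ˢ Icc (-1) 1)) :=
    (isCompact_Icc.prod isCompact_Icc).image (by fun_prop)
  obtain ⟨B, hB⟩ := hK.exists_bound_of_continuousOn (hFc.mono (by
    rintro _ ⟨p, hp, rfl⟩
    simpa using hp.1.1))
  have hcF {σ : ℝ} (hσ : 0 ≤ σ) : Continuous fun ξ : ℝ => F (σ + I * (l * ξ)) :=
    hFc.comp_continuous (by fun_prop) (fun ξ => by simpa using hσ)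
  have hright : Tendsto (fun σ : ℝ => ∫ ξ in (-1 : ℝ)..1, ((1 - |ξ| : ℝ) : ℂ) *
      exp (I * ξ * (l * y)) * F (σ + I * (l * ξ))) (𝓝[>] 0)
      (𝓝 (∫ ξ in (-1 : ℝ)..1, ((1 - |ξ| : ℝ) : ℂ) * exp (I * ξ * (l * y)) *
        F (I * (l * ξ)))) := by
    refine intervalIntegral.tendsto_integral_filter_of_dominated_convergence (fun _ => B)
      ?_ ?_ (by simp) (.of_forall fun ξ _ => ?_)
    · filter_upwards [self_mem_nhdsWithin] with σ hσ
      exact (Continuous.mul (by fun_prop) (hcF (le_of_lt hσ))).aestronglyMeasurable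
    · filter_upwards [Ioo_mem_nhdsGT one_pos] with σ hσ
      refine .of_forall fun ξ hξ => ?_
      rw [uIoc_of_le (by norm_num)] at hξ
      have hb := hB _ ⟨(σ, ξ), ⟨⟨hσ.1.le, hσ.2.le⟩, ⟨hξ.1.le, hξ.2⟩⟩, rfl⟩
      rw [norm_mul, norm_mul, show I * (ξ : ℂ) * (l * y) = ((ξ * (l * y) : ℝ) : ℂ) * I by
          push_cast; ring, norm_exp_ofReal_mul_I, norm_real, mul_one]
      have h1 : ‖1 - |ξ|‖ ≤ 1 := by
        have : |ξ| ≤ 1 := abs_le.mpr ⟨hξ.1.le, hξ.2⟩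
        rw [Real.norm_of_nonneg (by linarith)]
        linarith [abs_nonneg ξ]
      calc _ ≤ 1 * B := mul_le_mul h1 hb (norm_nonneg _) zero_le_one
        _ = B := one_mul B
    · refine Tendsto.const_mul _ ?_
      have h0 : ContinuousWithinAt F {z | 0 ≤ z.re} (I * (l * ξ)) := hFc _ (by simp)
      refine h0.tendsto.comp (tendsto_nhdsWithin_iff.mpr ⟨?_, ?_⟩)
      · refine Tendsto.mono_left ?_ nhdsWithin_le_nhds
        have : Continuous fun σ : ℝ => (σ + I * (l * ξ) : ℂ) := by fun_prop
        simpa using this.tendsto 0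
      · filter_upwards [self_mem_nhdsWithin] with σ hσ
        simpa using (mem_Ioi.mp hσ).le
  refine tendsto_nhds_unique hleft (hright.congr' ?_)
  filter_upwards [self_mem_nhdsWithin] with σ hσ
  exact (integral_mul_exp_mul_sinc_half_sq hm hC hF l y hσ).symm

open MeasureTheory Set in
/-- If the Laplace transform of a bounded function extends continuously to the closed half plane,
then the convolutions of the function with the Fejér kernels tend to `0`. -/
theorem tendsto_integral_mul_sinc_half_sq {h : ℝ → ℝ} (hm : Measurable h) {C : ℝ}
    (hC : ∀ t, |h t| ≤ C) {F : ℂ → ℂ} (hFc : ContinuousOn F {z | 0 ≤ z.re})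
    (hF : ∀ z : ℂ, 0 < z.re → F z = ∫ t in Ioi (0 : ℝ), (h t : ℂ) * Complex.exp (-z * t))
    {l : ℝ} (hl : 0 < l) :
    Tendsto (fun y : ℝ => ∫ t in Ioi (0 : ℝ), h t * Real.sinc (l * (y - t) / 2) ^ 2)
      atTop (𝓝 0) := by
  have key : Tendsto (fun y : ℝ => ((∫ t in Ioi (0 : ℝ), h t * Real.sinc (l * (y - t) / 2) ^ 2 : ℝ) : ℂ))
      atTop (𝓝 0) := by
    -- In the boundary identity `y` enters only through the phase, so the Riemann–Lebesgue lemma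
    -- applies.
    have hRL := (Real.tendsto_integral_exp_smul_cocompact ((Ioc (-1 : ℝ) 1).indicator fun ξ : ℝ =>
      ((1 - |ξ| : ℝ) : ℂ) * F (Complex.I * (l * ξ))))
    have hy : Tendsto (fun y : ℝ => -(l * y / (2 * Real.pi))) atTop (cocompact ℝ) := by
      refine Tendsto.mono_right ?_ atBot_le_cocompact
      exact tendsto_neg_atTop_atBot.comp
        ((tendsto_id.const_mul_atTop hl).atTop_div_const (by positivity))
    refine (hRL.comp hy).congr fun y => ?_
    rw [integral_mul_sinc_half_sq hm hC hFc hF hl, intervalIntegral.integral_of_le (by norm_num),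
      Function.comp_apply, ← integral_indicator measurableSet_Ioc]
    refine integral_congr_ae (.of_forall fun ξ => ?_)
    by_cases hξ : ξ ∈ Ioc (-1 : ℝ) 1
    · simp only [hξ, indicator_of_mem]
      rw [Circle.smul_def, Real.fourierChar_apply]
      have : 2 * Real.pi * (-(ξ * -(l * y / (2 * Real.pi)))) = ξ * (l * y) := by
        field_simp
      rw [this, smul_eq_mul]
      push_cast
      ring_nf
    · simp [hξ]
  have := (Complex.continuous_re.tendsto 0).comp key
  simpa [Function.comp_def] using this

/-! ### The Tauberian theorem -/

open MeasureTheory Set in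
lemma integrable_sinc_sq_shift {l : ℝ} (hl : 0 < l) (y : ℝ) :
    Integrable fun t : ℝ => Real.sinc (l * (y - t) / 2) ^ 2 :=
  (integrable_sinc_half_sq.comp_mul_left' hl.ne').comp_sub_left y

-- The kernel is centred at `y + δ`, so the window `(y, y + 2δ]` lies to the right of `y`, where
-- monotonicity gives `u t ≥ u y * exp(-2δ)`. The rest of the integral is nonnegative and dropped.
-- This bounds `u y` from above.
open MeasureTheory Set in
lemma mul_integral_sinc_sq_le {u : ℝ → ℝ} (hm : Measurable u) (h0 : ∀ t, 0 ≤ u t) {C : ℝ}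
    (hC : ∀ t, u t ≤ C) (hmono : Monotone fun t => u t * Real.exp t) {l δ y : ℝ} (hl : 0 < l)
    (hδ : 0 ≤ δ) (hy : 0 < y) :
    u y * Real.exp (-(2 * δ)) * ∫ v in -δ..δ, Real.sinc (l * v / 2) ^ 2 ≤
      ∫ t in Ioi (0 : ℝ), u t * Real.sinc (l * (y + δ - t) / 2) ^ 2 := by
  have hint : Integrable fun t => u t * Real.sinc (l * (y + δ - t) / 2) ^ 2 :=
    (integrable_sinc_sq_shift hl _).bdd_mul (c := C) hm.aestronglyMeasurable
      (.of_forall fun t => by rw [Real.norm_of_nonneg (h0 t)]; exact hC t)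
  have hJ : ∫ v in -δ..δ, Real.sinc (l * v / 2) ^ 2 =
      ∫ t in Ioc y (y + 2 * δ), Real.sinc (l * (y + δ - t) / 2) ^ 2 := by
    rw [← intervalIntegral.integral_of_le (by linarith),
      intervalIntegral.integral_comp_sub_left (fun v => Real.sinc (l * v / 2) ^ 2)]
    ring_nf
  rw [hJ, ← integral_const_mul]
  calc _ ≤ ∫ t in Ioc y (y + 2 * δ), u t * Real.sinc (l * (y + δ - t) / 2) ^ 2 := by
        refine setIntegral_mono_on ((integrable_sinc_sq_shift hl _).const_mul _).integrableOn
          hint.integrableOn measurableSet_Ioc fun t ht => ?_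
        refine mul_le_mul_of_nonneg_right ?_ (sq_nonneg _)
        have h1 : u y * Real.exp y ≤ u t * Real.exp t := hmono ht.1.le
        have h2 : u t * Real.exp t ≤ u t * Real.exp (y + 2 * δ) :=
          mul_le_mul_of_nonneg_left (Real.exp_le_exp.mpr ht.2) (h0 t)
        rw [Real.exp_add, ← mul_assoc] at h2
        have h3 : u y ≤ u t * Real.exp (2 * δ) := by
          have := h1.trans h2
          have he := Real.exp_pos y
          nlinarith
        rw [Real.exp_neg, ← div_eq_mul_inv, div_le_iff₀ (Real.exp_pos _)]
        exact h3
    _ ≤ _ := setIntegral_mono_set hint.integrableOn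
        (.of_forall fun t => mul_nonneg (h0 t) (sq_nonneg _))
        (LE.le.eventuallyLE fun t ht => hy.trans ht.1)

-- The mirror image: the window `(y - 2δ, y]` lies to the left of `y`, where `u t ≤ u y * exp(2δ)`,
-- and outside it only `u ≤ C` is used. This bounds `u y` from below.
open MeasureTheory Set in
lemma integral_mul_sinc_sq_le {u : ℝ → ℝ} (hm : Measurable u) (h0 : ∀ t, 0 ≤ u t) {C : ℝ}
    (hC : ∀ t, u t ≤ C) (hmono : Monotone fun t => u t * Real.exp t) {l δ y : ℝ} (hl : 0 < l)
    (hδ : 0 ≤ δ) (hy : 2 * δ ≤ y) :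
    ∫ t in Ioi (0 : ℝ), u t * Real.sinc (l * (y - δ - t) / 2) ^ 2 ≤
      u y * Real.exp (2 * δ) * (∫ v in -δ..δ, Real.sinc (l * v / 2) ^ 2) +
      C * ((∫ v, Real.sinc (l * v / 2) ^ 2) - ∫ v in -δ..δ, Real.sinc (l * v / 2) ^ 2) := by
  have hKi := integrable_sinc_sq_shift hl (y - δ)
  have hint : Integrable fun t => u t * Real.sinc (l * (y - δ - t) / 2) ^ 2 :=
    hKi.bdd_mul (c := C) hm.aestronglyMeasurable
      (.of_forall fun t => by rw [Real.norm_of_nonneg (h0 t)]; exact hC t)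
  have hJ : ∫ v in -δ..δ, Real.sinc (l * v / 2) ^ 2 =
      ∫ t in Ioc (y - 2 * δ) y, Real.sinc (l * (y - δ - t) / 2) ^ 2 := by
    rw [← intervalIntegral.integral_of_le (by linarith),
      intervalIntegral.integral_comp_sub_left (fun v => Real.sinc (l * v / 2) ^ 2)]
    ring_nf
  have hT : ∫ v, Real.sinc (l * v / 2) ^ 2 = ∫ t, Real.sinc (l * (y - δ - t) / 2) ^ 2 :=
    (integral_sub_left_eq_self (fun v => Real.sinc (l * v / 2) ^ 2) volume (y - δ)).symm
  have hTJ := integral_add_compl (measurableSet_Ioc (a := y - 2 * δ) (b := y)) hKi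
  rw [hJ, hT, ← hTJ, add_sub_cancel_left, ← integral_const_mul, ← integral_const_mul]
  have hsub : Ioc (y - 2 * δ) y ⊆ Ioi 0 := fun t ht => by
    have := ht.1
    rw [mem_Ioi]; linarith
  rw [← inter_union_sdiff (Ioi (0 : ℝ)) (Ioc (y - 2 * δ) y), inter_eq_self_of_subset_right hsub,
    setIntegral_union disjoint_sdiff_right (measurableSet_Ioi.diff measurableSet_Ioc)
      hint.integrableOn hint.integrableOn]
  refine add_le_add ?_ ?_
  · refine setIntegral_mono_on hint.integrableOn (hKi.const_mul _).integrableOn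
      measurableSet_Ioc fun t ht => ?_
    refine mul_le_mul_of_nonneg_right ?_ (sq_nonneg _)
    have h1 : u t * Real.exp t ≤ u y * Real.exp y := hmono ht.2
    have h2 : u y * Real.exp y ≤ u y * Real.exp (2 * δ + t) :=
      mul_le_mul_of_nonneg_left (Real.exp_le_exp.mpr (by linarith [ht.1])) (h0 y)
    rw [Real.exp_add, ← mul_assoc] at h2
    exact le_of_mul_le_mul_right (h1.trans h2) (Real.exp_pos t)
  · calc _ ≤ ∫ t in Ioi 0 \ Ioc (y - 2 * δ) y, C * Real.sinc (l * (y - δ - t) / 2) ^ 2 :=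
        setIntegral_mono hint.integrableOn (hKi.const_mul _).integrableOn fun t =>
          mul_le_mul_of_nonneg_right (hC t) (sq_nonneg _)
      _ ≤ _ := setIntegral_mono_set (hKi.const_mul _).integrableOn
        (.of_forall fun t => mul_nonneg ((h0 t).trans (hC t)) (sq_nonneg _))
        (LE.le.eventuallyLE fun t ht => ht.2)

open MeasureTheory Set in
lemma integral_sinc_half_sq_pos : 0 < ∫ v : ℝ, Real.sinc (v / 2) ^ 2 :=
  integral_pos_of_integrable_nonneg_nonzero (x := 0) (by fun_prop) integrable_sinc_half_sq
    (fun _ => sq_nonneg _) (by simp)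

open MeasureTheory Set in
lemma integral_sinc_sq_mul {l : ℝ} (hl : 0 < l) :
    ∫ v, Real.sinc (l * v / 2) ^ 2 = l⁻¹ * ∫ v : ℝ, Real.sinc (v / 2) ^ 2 := by
  have := Measure.integral_comp_mul_left (fun v => Real.sinc (v / 2) ^ 2) l
  rw [abs_of_pos (inv_pos.mpr hl), smul_eq_mul] at this
  exact this

open MeasureTheory Set in
lemma tendsto_mul_integral_sinc_sq {δ : ℝ} (hδ : 0 < δ) :
    Tendsto (fun l : ℝ => l * ∫ v in -δ..δ, Real.sinc (l * v / 2) ^ 2) atTop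
      (𝓝 (∫ v : ℝ, Real.sinc (v / 2) ^ 2)) := by
  have hδl : Tendsto (fun l : ℝ => l * δ) atTop atTop := tendsto_id.atTop_mul_const hδ
  refine (intervalIntegral_tendsto_integral integrable_sinc_half_sq
    (tendsto_neg_atTop_atBot.comp hδl) hδl).congr' ?_
  filter_upwards [eventually_gt_atTop 0] with l hl
  have := intervalIntegral.integral_comp_mul_left (a := -δ) (b := δ)
    (fun v => Real.sinc (v / 2) ^ 2) hl.ne'
  rw [this, smul_eq_mul, mul_inv_cancel_left₀ hl.ne']
  simp

open MeasureTheory Set in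
/-- A Tauberian theorem: if `u` is bounded, `u t * exp t` is monotone, and the Laplace transform of
`u - 1` extends continuously to the closed half plane, then `u` tends to `1`. -/
theorem tendsto_one_of_laplace_continuousOn {u : ℝ → ℝ} (hm : Measurable u) (h0 : ∀ t, 0 ≤ u t)
    {C : ℝ} (hC : ∀ t, u t ≤ C) (hmono : Monotone fun t => u t * Real.exp t) {F : ℂ → ℂ}
    (hFc : ContinuousOn F {z | 0 ≤ z.re})
    (hF : ∀ z : ℂ, 0 < z.re →
      F z = ∫ t in Ioi (0 : ℝ), ((u t - 1 : ℝ) : ℂ) * Complex.exp (-z * t)) :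
    Tendsto u atTop (𝓝 1) := by
  set c := ∫ v : ℝ, Real.sinc (v / 2) ^ 2 with hc
  have hcpos : 0 < c := integral_sinc_half_sq_pos
  -- The normalised means of `u` tend to `1`: those of `u - 1` vanish in the limit, and the kernel's
  -- mass on `t > 0` tends to its full mass `c / l`.
  have hA {l : ℝ} (hl : 0 < l) : Tendsto (fun y => (l / c) *
      ∫ t in Ioi (0 : ℝ), u t * Real.sinc (l * (y - t) / 2) ^ 2) atTop (𝓝 1) := by
    have h1 := tendsto_integral_mul_sinc_half_sq (h := fun t => u t - 1) (by fun_prop) (C := C + 1)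
      (fun t => abs_le.mpr ⟨by linarith [h0 t, (h0 t).trans (hC t)], by linarith [hC t]⟩) hFc hF hl
    have h2 : Tendsto (fun y => ∫ t in Ioi (0 : ℝ), Real.sinc (l * (y - t) / 2) ^ 2) atTop
        (𝓝 (l⁻¹ * c)) := by
      rw [hc, ← integral_sinc_sq_mul hl]
      have hi : Integrable fun t : ℝ => Real.sinc (l * t / 2) ^ 2 :=
        integrable_sinc_half_sq.comp_mul_left' hl.ne'
      have h3 := (aecover_Iio (μ := volume) (tendsto_id (α := ℝ) (x := atTop))).integral_tendsto_of_countably_generated hi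
      refine h3.congr fun y => ?_
      rw [← integral_indicator measurableSet_Iio, ← integral_indicator measurableSet_Ioi,
        ← integral_sub_left_eq_self _ volume y]
      refine integral_congr_ae (.of_forall fun t => ?_)
      simp [indicator]
    have h3 := (h1.add h2).const_mul (l / c)
    have h4 : l / c * (0 + l⁻¹ * c) = 1 := by field_simp; simp
    rw [h4] at h3
    refine h3.congr fun y => ?_
    have hK := (integrable_sinc_sq_shift hl y).integrableOn (s := Ioi 0)
    have hK' : IntegrableOn (fun t => u t * Real.sinc (l * (y - t) / 2) ^ 2) (Ioi 0) :=
      hK.bdd_mul (c := C) hm.aestronglyMeasurable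
        (.of_forall fun t => by rw [Real.norm_of_nonneg (h0 t)]; exact hC t)
    simp_rw [sub_mul, one_mul]
    rw [integral_sub hK' hK, sub_add_cancel]
  rw [Metric.tendsto_nhds]
  intro ε hε
  obtain ⟨δ, hδε, hδ⟩ : ∃ δ : ℝ, (Real.exp (2 * δ) < 1 + ε ∧ 1 - ε < Real.exp (-(2 * δ))) ∧ 0 < δ := by
    have h1 : Tendsto (fun δ : ℝ => Real.exp (2 * δ)) (𝓝[>] 0) (𝓝 1) := by
      refine Tendsto.mono_left ?_ nhdsWithin_le_nhds
      simpa using (by fun_prop : Continuous fun δ : ℝ => Real.exp (2 * δ)).tendsto 0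
    have h2 : Tendsto (fun δ : ℝ => Real.exp (-(2 * δ))) (𝓝[>] 0) (𝓝 1) := by
      refine Tendsto.mono_left ?_ nhdsWithin_le_nhds
      simpa using (by fun_prop : Continuous fun δ : ℝ => Real.exp (-(2 * δ))).tendsto 0
    exact (((h1.eventually_lt_const (by linarith)).and
      (h2.eventually_const_lt (by linarith))).and self_mem_nhdsWithin).exists
  -- The order of choice is `δ` from `ε`, then `l` so large that the share `j` of the kernel's mass
  -- in `[-δ, δ]` is close to `1`, and only then `y → ∞`.
  have hj : Tendsto (fun l : ℝ => (l * ∫ v in -δ..δ, Real.sinc (l * v / 2) ^ 2) / c) atTop (𝓝 1) := by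
    have := (tendsto_mul_integral_sinc_sq hδ).div_const c
    rwa [← hc, div_self hcpos.ne'] at this
  have hj1 := (tendsto_const_nhds (x := Real.exp (2 * δ))).div hj one_ne_zero
  have hj2 := (((((hj.const_sub 1).const_mul C).const_sub 1)).const_mul
    (Real.exp (-(2 * δ)))).div hj one_ne_zero
  simp only [sub_self, mul_zero, sub_zero, mul_one, div_one] at hj1 hj2
  obtain ⟨l, ⟨⟨hl1, hl2⟩, hl3⟩, hl⟩ := (((hj1.eventually_lt_const hδε.1).and
    (hj2.eventually_const_lt hδε.2)).and (hj.eventually_const_lt (zero_lt_one)) |>.and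
      (eventually_gt_atTop 0)).exists
  simp only [Pi.div_apply] at hl1 hl2
  set J := ∫ v in -δ..δ, Real.sinc (l * v / 2) ^ 2 with hJdef
  set j := l * J / c with hjdef
  have hB1 := (((hA hl).comp (tendsto_atTop_add_const_right atTop δ tendsto_id)).const_mul
    (Real.exp (2 * δ))).div_const j
  have hB2 := ((((hA hl).comp (tendsto_atTop_add_const_right atTop (-δ) tendsto_id)).sub_const
    (C * (1 - j))).const_mul (Real.exp (-(2 * δ)))).div_const j
  simp only [mul_one, Function.comp_def, id_eq] at hB1 hB2
  filter_upwards [hB1.eventually_lt_const hl1, hB2.eventually_const_lt hl2,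
    eventually_gt_atTop (2 * δ)] with y hy1 hy2 hy
  have hup := mul_integral_sinc_sq_le hm h0 hC hmono hl hδ.le (by linarith : 0 < y)
  have hlo := integral_mul_sinc_sq_le hm h0 hC hmono hl hδ.le hy.le
  rw [← hJdef] at hup hlo
  rw [integral_sinc_sq_mul hl, ← hc] at hlo
  have hlc : 0 < l / c := by positivity
  have hup' := mul_le_mul_of_nonneg_left hup hlc.le
  have hlo' := mul_le_mul_of_nonneg_left hlo hlc.le
  have e1 : l / c * (u y * Real.exp (-(2 * δ)) * J) = u y * j / Real.exp (2 * δ) := by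
    rw [Real.exp_neg, hjdef]; field_simp
  have e2 : l / c * (u y * Real.exp (2 * δ) * J + C * (l⁻¹ * c - J)) =
      u y * Real.exp (2 * δ) * j + C * (1 - j) := by
    rw [hjdef]; field_simp
  rw [e1, div_le_iff₀ (Real.exp_pos _)] at hup'
  rw [e2] at hlo'
  rw [Real.dist_eq, abs_lt]
  constructor
  · have : Real.exp (-(2 * δ)) * (l / c * (∫ t in Ioi (0 : ℝ), u t *
        Real.sinc (l * (y - δ - t) / 2) ^ 2) - C * (1 - j)) / j ≤ u y := by
      rw [div_le_iff₀ hl3, Real.exp_neg, inv_mul_le_iff₀ (Real.exp_pos _)]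
      linarith
    rw [← sub_eq_add_neg] at hy2
    linarith
  · have : u y ≤ Real.exp (2 * δ) * (l / c * ∫ t in Ioi (0 : ℝ), u t *
        Real.sinc (l * (y + δ - t) / 2) ^ 2) / j := by
      rw [le_div_iff₀ hl3]
      linarith
    linarith

/-! ### The prime number theorem -/

-- Abel summation expresses the Dirichlet series as an integral of `ψ` over `(1, ∞)`; substituting
-- `exp t` turns it into a Laplace transform.
open MeasureTheory Set in
lemma LSeries_vonMangoldt_eq_mul_integral_exp {z : ℂ} (hz : 0 < z.re) :
    LSeries (fun n => (ArithmeticFunction.vonMangoldt n : ℂ)) (1 + z) = (1 + z) *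
      ∫ t in Ioi (0 : ℝ), ((Chebyshev.psi (Real.exp t) * Real.exp (-t) : ℝ) : ℂ) *
        Complex.exp (-z * t) := by
  have hpsi (n : ℕ) : ∑ k ∈ Finset.Icc 1 n, ArithmeticFunction.vonMangoldt k = Chebyshev.psi n := by
    rw [Chebyshev.psi, Nat.floor_natCast]; rfl
  have hO : (fun n => ∑ k ∈ Finset.Icc 1 n, ArithmeticFunction.vonMangoldt k) =O[atTop]
      fun n => (n : ℝ) ^ (1 : ℝ) := by
    refine Asymptotics.IsBigO.of_bound (Real.log 4 + 4) (.of_forall fun n => ?_)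
    rw [hpsi, Real.rpow_one, Real.norm_of_nonneg (Chebyshev.psi_nonneg _),
      Real.norm_of_nonneg n.cast_nonneg]
    exact Chebyshev.psi_le_const_mul_self n.cast_nonneg
  rw [LSeries_eq_mul_integral_of_nonneg _ zero_le_one (by simpa using hz) hO
    (fun n => ArithmeticFunction.vonMangoldt_nonneg)]
  congr 1
  have himg : Real.exp '' Ioi 0 = Ioi 1 := by
    ext x
    constructor
    · rintro ⟨t, ht, rfl⟩
      exact Real.one_lt_exp_iff.mpr ht
    · intro hx
      exact ⟨Real.log x, Real.log_pos hx, Real.exp_log (one_pos.trans hx)⟩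
  rw [← himg, integral_image_eq_integral_abs_deriv_smul measurableSet_Ioi
    (fun t _ => (Real.hasDerivAt_exp t).hasDerivWithinAt) Real.exp_injective.injOn]
  refine integral_congr_ae (.of_forall fun t => ?_)
  simp only
  rw [← Complex.ofReal_sum, hpsi, ← Chebyshev.psi_eq_psi_coe_floor, abs_of_pos (Real.exp_pos t),
    Complex.real_smul, Complex.ofReal_exp, Complex.cpow_def_of_ne_zero (Complex.exp_ne_zero _),
    Complex.log_exp (by simpa using Real.pi_pos) (by simpa using Real.pi_pos.le)]
  push_cast
  have h1 : Complex.exp (t * -(1 + z + 1)) =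
      Complex.exp (-t) * Complex.exp (-t) * Complex.exp (-z * t) := by
    rw [← Complex.exp_add, ← Complex.exp_add]
    ring_nf
  have h2 : Complex.exp t * Complex.exp (-t) = 1 := by
    rw [← Complex.exp_add, add_neg_cancel, Complex.exp_zero]
  rw [h1]
  linear_combination (Chebyshev.psi (Real.exp t) * Complex.exp (-t) * Complex.exp (-z * t)) * h2

open MeasureTheory Set in
lemma tendsto_psi_exp_mul_exp_neg :
    Tendsto (fun t => Chebyshev.psi (Real.exp t) * Real.exp (-t)) atTop (𝓝 1) := by
  have hm : Measurable Chebyshev.psi := Chebyshev.psi_mono.measurable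
  -- Modulo `1` the residue class contains every integer, so `g` is `-ζ'/ζ` with its pole at `1`
  -- removed; its continuity on `Re s ≥ 1` encodes the nonvanishing of `ζ` there.
  set g := ArithmeticFunction.vonMangoldt.LFunctionResidueClassAux (1 : ZMod 1) with hg
  have hgc : ContinuousOn g {s | 1 ≤ s.re} :=
    ArithmeticFunction.vonMangoldt.continuousOn_LFunctionResidueClassAux (1 : ZMod 1)
  refine tendsto_one_of_laplace_continuousOn (C := Real.log 4 + 4) (by fun_prop)
    (fun t => mul_nonneg (Chebyshev.psi_nonneg _) (Real.exp_pos _).le) (fun t => ?_) ?_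
    -- With `s = 1 + z` this is `(g(s) + 1/z)/s - 1/z`, the transform of `ψ(exp t) exp(-t)` minus
    -- that of `1`; the poles at `z = 0` cancel.
    (F := fun z => (g (1 + z) - 1) / (1 + z)) ?_ fun z hz => ?_
  · rw [Real.exp_neg, ← div_eq_mul_inv, div_le_iff₀ (Real.exp_pos t)]
    exact Chebyshev.psi_le_const_mul_self (Real.exp_pos t).le
  · simp_rw [mul_assoc, ← Real.exp_add, neg_add_cancel, Real.exp_zero, mul_one]
    exact Chebyshev.psi_mono.comp Real.exp_monotone
  · refine ContinuousOn.div ((hgc.comp (by fun_prop) fun z hz => ?_).sub continuousOn_const)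
      (by fun_prop) fun z hz h => ?_
    · simpa using hz
    · have := congrArg Complex.re h
      have hz' : 0 ≤ z.re := hz
      simp at this
      linarith
  · have hz1 : 1 + z ≠ 0 := fun h => by
      have := congrArg Complex.re h
      simp at this
      linarith
    have hz0 : z ≠ 0 := by rintro rfl; simp at hz
    have hgz := ArithmeticFunction.vonMangoldt.eqOn_LFunctionResidueClassAux
      (a := (1 : ZMod 1)) isUnit_one (x := 1 + z) (by simpa using hz)
    have hres : (fun n => ((ArithmeticFunction.vonMangoldt.residueClass (1 : ZMod 1) n : ℝ) : ℂ)) =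
        fun n => (ArithmeticFunction.vonMangoldt n : ℂ) := by
      ext n
      rw [ArithmeticFunction.vonMangoldt.residueClass, indicator_of_mem]
      exact Subsingleton.elim _ _
    simp only [Nat.totient_one, Nat.cast_one, inv_one, add_sub_cancel_left] at hgz
    rw [hres, LSeries_vonMangoldt_eq_mul_integral_exp hz] at hgz
    rw [← hg] at hgz
    rw [hgz]
    have hE : ∫ t in Ioi (0 : ℝ), Complex.exp (-z * t) = 1 / z := by
      rw [integral_exp_mul_complex_Ioi (by simpa using hz)]
      simp
    have hEi : IntegrableOn (fun t : ℝ => Complex.exp (-z * t)) (Ioi 0) :=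
      integrableOn_exp_mul_complex_Ioi (by simpa using hz) 0
    simp only [Complex.ofReal_sub, Complex.ofReal_one, sub_mul, one_mul]
    rw [integral_sub _ hEi, hE]
    · field_simp
      ring
    · refine hEi.bdd_mul (c := Real.log 4 + 4) (Measurable.aestronglyMeasurable (by fun_prop))
        (.of_forall fun t => ?_)
      rw [Complex.norm_real, Real.norm_of_nonneg
        (mul_nonneg (Chebyshev.psi_nonneg _) (Real.exp_pos _).le), Real.exp_neg, ← div_eq_mul_inv,
        div_le_iff₀ (Real.exp_pos t)]
      exact Chebyshev.psi_le_const_mul_self (Real.exp_pos t).le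

/-- The prime number theorem for Chebyshev's `ψ`. -/
theorem tendsto_psi_div_self : Tendsto (fun x => Chebyshev.psi x / x) atTop (𝓝 1) := by
  refine (tendsto_psi_exp_mul_exp_neg.comp Real.tendsto_log_atTop).congr' ?_
  filter_upwards [eventually_gt_atTop 0] with x hx
  rw [Function.comp_apply, Real.exp_neg, Real.exp_log hx, div_eq_mul_inv]

/-- The prime number theorem for Chebyshev's `θ`. -/
theorem tendsto_theta_div_self : Tendsto (fun x => Chebyshev.theta x / x) atTop (𝓝 1) := by
  have h : Tendsto (fun x => (Chebyshev.psi - Chebyshev.theta) x / x) atTop (𝓝 0) := by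
    refine (Chebyshev.isBigO_psi_sub_theta_sqrt.trans_isLittleO ?_).tendsto_div_nhds_zero
    refine Asymptotics.isLittleO_of_tendsto' ?_ ((tendsto_rpow_neg_atTop
      (show (0 : ℝ) < 1 / 2 by norm_num)).congr' ?_)
    · filter_upwards [eventually_gt_atTop 0] with x hx h using absurd h hx.ne'
    · filter_upwards [eventually_gt_atTop 0] with x hx
      rw [Real.sqrt_eq_rpow, eq_div_iff hx.ne']
      nth_rewrite 2 [← Real.rpow_one x]
      rw [← Real.rpow_add hx]
      norm_num
  simpa [sub_div] using tendsto_psi_div_self.sub h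

/-! ### Sums of `p^(-α)` over primes -/

-- Beyond some `T`, `θ(t)` differs from `t` by at most `ε (1-α) t`, and the factor `1-α` cancels on
-- integration. The range below `T` contributes only to the constant `K`.
open MeasureTheory Set in
lemma abs_integral_rpow_mul_theta_sub_le {α : ℝ} (hα0 : 0 < α) (hα1 : α < 1) {ε : ℝ} (hε : 0 < ε) :
    ∃ K : ℝ, ∀ᶠ b : ℝ in atTop,
      |(∫ t in (1 : ℝ)..b, t ^ (-α - 1) * Chebyshev.theta t) - b ^ (1 - α) / (1 - α)| ≤
        K + ε * b ^ (1 - α) := by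
  have h1α : 0 < 1 - α := by linarith
  have hθ : ∀ᶠ t : ℝ in atTop, |Chebyshev.theta t - t| ≤ ε * (1 - α) * t := by
    filter_upwards [Metric.tendsto_nhds.mp tendsto_theta_div_self _ (mul_pos hε h1α),
      eventually_gt_atTop 0] with t ht ht0
    rw [Real.dist_eq, div_sub_one ht0.ne', abs_div, abs_of_pos ht0, div_lt_iff₀ ht0] at ht
    exact ht.le
  obtain ⟨T, hT⟩ := eventually_atTop.mp (hθ.and (eventually_ge_atTop 1))
  have hT1 : 1 ≤ T := (hT T le_rfl).2
  have hcont {a b : ℝ} (ha : 1 ≤ a) (hb : 1 ≤ b) (r : ℝ) :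
      ContinuousOn (fun t : ℝ => t ^ r) (uIcc a b) :=
    continuousOn_id.rpow_const fun t ht =>
      Or.inl (by have := (le_min ha hb).trans ht.1; simp only [id]; linarith)
  have hi1 {a b : ℝ} (ha : 1 ≤ a) (hb : 1 ≤ b) :
      IntervalIntegrable (fun t : ℝ => t ^ (-α - 1) * Chebyshev.theta t) volume a b :=
    (Chebyshev.theta_mono.intervalIntegrable).continuousOn_mul (hcont ha hb _)
  have hi2 {a b : ℝ} (ha : 1 ≤ a) (hb : 1 ≤ b) :
      IntervalIntegrable (fun t : ℝ => t ^ (-α)) volume a b := (hcont ha hb _).intervalIntegrable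
  have hpow {a b : ℝ} : ∫ t in a..b, t ^ (-α) = (b ^ (1 - α) - a ^ (1 - α)) / (1 - α) := by
    rw [integral_rpow (Or.inl (by linarith)), neg_add_eq_sub]
  refine ⟨|∫ t in (1 : ℝ)..T, (t ^ (-α - 1) * Chebyshev.theta t - t ^ (-α))| + 1 / (1 - α), ?_⟩
  filter_upwards [eventually_ge_atTop T] with b hb
  have hb1 := hT1.trans hb
  have hsplit : (∫ t in (1 : ℝ)..b, t ^ (-α - 1) * Chebyshev.theta t) - b ^ (1 - α) / (1 - α) =
      (∫ t in (1 : ℝ)..T, (t ^ (-α - 1) * Chebyshev.theta t - t ^ (-α))) +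
      (∫ t in T..b, (t ^ (-α - 1) * Chebyshev.theta t - t ^ (-α))) + -(1 / (1 - α)) := by
    rw [intervalIntegral.integral_add_adjacent_intervals
      ((hi1 le_rfl hT1).sub (hi2 le_rfl hT1)) ((hi1 hT1 hb1).sub (hi2 hT1 hb1)),
      intervalIntegral.integral_sub (hi1 le_rfl hb1) (hi2 le_rfl hb1), hpow, Real.one_rpow]
    ring
  have htail : |∫ t in T..b, (t ^ (-α - 1) * Chebyshev.theta t - t ^ (-α))| ≤ ε * b ^ (1 - α) := by
    calc |∫ t in T..b, (t ^ (-α - 1) * Chebyshev.theta t - t ^ (-α))|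
        ≤ ∫ t in T..b, ε * (1 - α) * t ^ (-α) := by
          rw [← Real.norm_eq_abs]
          refine intervalIntegral.norm_integral_le_of_norm_le hb (.of_forall fun t ht => ?_)
            ((hi2 hT1 hb1).const_mul _)
          have ht0 : 0 < t := by linarith [ht.1]
          have e : t ^ (-α) = t ^ (-α - 1) * t := by
            rw [Real.rpow_sub_one ht0.ne']; field_simp
          rw [e, ← mul_sub, norm_mul, Real.norm_of_nonneg (by positivity), Real.norm_eq_abs]
          have := mul_le_mul_of_nonneg_left (hT t ht.1.le).1 (Real.rpow_pos_of_pos ht0 (-α - 1)).le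
          linarith
      _ ≤ ε * b ^ (1 - α) := by
          rw [intervalIntegral.integral_const_mul, hpow, mul_assoc, mul_div_cancel₀ _ h1α.ne']
          refine mul_le_mul_of_nonneg_left ?_ hε.le
          have : 0 ≤ T ^ (1 - α) := by positivity
          linarith
  rw [hsplit]
  refine (abs_add_le _ _).trans ?_
  rw [abs_neg, abs_of_pos (by positivity : 0 < 1 / (1 - α))]
  linarith [abs_add_le (∫ t in (1 : ℝ)..T, (t ^ (-α - 1) * Chebyshev.theta t - t ^ (-α)))
    (∫ t in T..b, (t ^ (-α - 1) * Chebyshev.theta t - t ^ (-α)))]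

/-- `∑_{p ≤ x} p ^ (-α) log p ~ x ^ (1 - α) / (1 - α)`. -/
lemma tendsto_sum_primes_rpow_mul_log {α : ℝ} (hα0 : 0 < α) (hα1 : α < 1) :
    Tendsto (fun x : ℝ => (∑ p ∈ Finset.Ioc 0 ⌊x⌋₊ with p.Prime, (p : ℝ) ^ (-α) * Real.log p) /
      x ^ (1 - α)) atTop (𝓝 (1 / (1 - α))) := by
  have hAbel : ∀ x : ℝ, 1 ≤ x → ∑ p ∈ Finset.Ioc 0 ⌊x⌋₊ with p.Prime, (p : ℝ) ^ (-α) * Real.log p =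
      x ^ (-α) * Chebyshev.theta x + α * ∫ t in (1 : ℝ)..x, t ^ (-α - 1) * Chebyshev.theta t := by
    intro x hx
    set c : ℕ → ℝ := fun n => if n.Prime then Real.log n else 0 with hc
    have hθ (t : ℝ) : ∑ k ∈ Finset.Icc 0 ⌊t⌋₊, c k = Chebyshev.theta t := by
      rw [Chebyshev.theta_eq_sum_Icc, Finset.sum_filter]
    have hderiv : ∀ t ∈ Set.Icc 1 x, HasDerivAt (fun t : ℝ => t ^ (-α)) (-α * t ^ (-α - 1)) t :=
      fun t ht => Real.hasDerivAt_rpow_const (Or.inl (by linarith [ht.1]))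
    have h := sum_mul_eq_sub_integral_mul₀ (f := fun t : ℝ => t ^ (-α)) c (by simp [hc]) x
      (fun t ht => (hderiv t ht).differentiableAt) ?_
    · simp_rw [hθ] at h
      have h1 : ∑ p ∈ Finset.Ioc 0 ⌊x⌋₊ with p.Prime, (p : ℝ) ^ (-α) * Real.log p =
          ∑ k ∈ Finset.Icc 0 ⌊x⌋₊, (k : ℝ) ^ (-α) * c k := by
        rw [← Finset.add_sum_Ioc_eq_sum_Icc (Nat.zero_le _), Finset.sum_filter]
        simp [hc]
      rw [h1, h, intervalIntegral.integral_of_le hx, ← MeasureTheory.integral_const_mul,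
        sub_eq_add_neg, ← MeasureTheory.integral_neg]
      congr 1
      refine MeasureTheory.setIntegral_congr_fun measurableSet_Ioc fun t ht => ?_
      rw [(hderiv t ⟨ht.1.le, ht.2⟩).deriv]
      ring
    · refine MeasureTheory.IntegrableOn.congr_fun (f := fun t => -α * t ^ (-α - 1))
        (ContinuousOn.integrableOn_Icc ?_) (fun t ht => (hderiv t ht).deriv.symm) measurableSet_Icc
      exact continuousOn_const.mul (continuousOn_id.rpow_const fun t ht =>
        Or.inl (by have := ht.1; simp only [id]; linarith))
  have hθ1 : Tendsto (fun x : ℝ => x ^ (-α) * Chebyshev.theta x / x ^ (1 - α)) atTop (𝓝 1) := by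
    refine tendsto_theta_div_self.congr' ?_
    filter_upwards [eventually_gt_atTop 0] with x hx
    rw [Real.rpow_neg hx.le, Real.rpow_sub hx, Real.rpow_one]
    have := (Real.rpow_pos_of_pos hx α).ne'
    field_simp
  have hpow : Tendsto (fun x : ℝ => x ^ (1 - α)) atTop atTop := tendsto_rpow_atTop (by linarith)
  have hI : Tendsto (fun x : ℝ => (∫ t in (1 : ℝ)..x, t ^ (-α - 1) * Chebyshev.theta t) / x ^ (1 - α))
      atTop (𝓝 (1 / (1 - α))) := by
    rw [Metric.tendsto_nhds]
    intro ε hε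
    obtain ⟨K, hK⟩ := abs_integral_rpow_mul_theta_sub_le hα0 hα1 (half_pos hε)
    have hKlim := (tendsto_const_nhds (x := K)).div_atTop hpow
    filter_upwards [hK, hKlim.eventually_lt_const (half_pos hε), eventually_gt_atTop 0]
      with x h1 h2 hx
    have hxp := Real.rpow_pos_of_pos hx (1 - α)
    have e : (∫ t in (1 : ℝ)..x, t ^ (-α - 1) * Chebyshev.theta t) / x ^ (1 - α) - 1 / (1 - α) =
        ((∫ t in (1 : ℝ)..x, t ^ (-α - 1) * Chebyshev.theta t) - x ^ (1 - α) / (1 - α)) /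
          x ^ (1 - α) := by
      have : 1 - α ≠ 0 := by linarith
      field_simp
    rw [Real.dist_eq, e, abs_div, abs_of_pos hxp, div_lt_iff₀ hxp]
    rw [div_lt_iff₀ hxp] at h2
    linarith
  have h := hθ1.add (hI.const_mul α)
  have e : 1 + α * (1 / (1 - α)) = 1 / (1 - α) := by
    have : 1 - α ≠ 0 := by linarith
    field_simp; ring
  rw [e] at h
  refine h.congr' ?_
  filter_upwards [eventually_ge_atTop 1] with x hx
  rw [hAbel x hx]
  ring

/-- `∑_{p ≤ x} p ^ (-α) ~ x ^ (1 - α) / ((1 - α) log x)`. -/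
lemma tendsto_sum_primes_rpow {α : ℝ} (hα0 : 0 < α) (hα1 : α < 1) :
    Tendsto (fun x : ℝ => (∑ p ∈ Finset.Ioc 0 ⌊x⌋₊ with p.Prime, (p : ℝ) ^ (-α)) *
      (Real.log x / x ^ (1 - α))) atTop (𝓝 (1 / (1 - α))) := by
  set A : ℝ → ℝ := fun x => ∑ p ∈ Finset.Ioc 0 ⌊x⌋₊ with p.Prime, (p : ℝ) ^ (-α) * Real.log p
    with hA
  set S : ℝ → ℝ := fun x => ∑ p ∈ Finset.Ioc 0 ⌊x⌋₊ with p.Prime, (p : ℝ) ^ (-α) with hS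
  have hAlim : Tendsto (fun x => A x / x ^ (1 - α)) atTop (𝓝 (1 / (1 - α))) :=
    tendsto_sum_primes_rpow_mul_log hα0 hα1
  have hAS (x : ℝ) (hx : 0 ≤ x) : A x ≤ S x * Real.log x := by
    rw [hA, hS, Finset.sum_mul]
    refine Finset.sum_le_sum fun p hp => ?_
    simp only [Finset.mem_filter, Finset.mem_Ioc] at hp
    refine mul_le_mul_of_nonneg_left (Real.log_le_log (by exact_mod_cast hp.1.1) ?_) (by positivity)
    exact (Nat.le_floor_iff hx).mp hp.1.2
  -- Primes up to `z` have `log p ≥ log 2`, larger ones `log p ≥ log z`. With `z = x^(1-δ)` below,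
  -- the first part is negligible and the second loses only a factor `1/(1-δ)`.
  have hSz (x z : ℝ) (hz : 1 < z) (hzx : z ≤ x) : S x ≤ A z / Real.log 2 + A x / Real.log z := by
    have hlog2 := Real.log_pos one_lt_two
    have hlogz := Real.log_pos hz
    have hAz : A z = ∑ p ∈ Finset.Ioc 0 ⌊x⌋₊ with p.Prime,
        if p ≤ ⌊z⌋₊ then (p : ℝ) ^ (-α) * Real.log p else 0 := by
      rw [hA, ← Finset.sum_filter]
      refine Finset.sum_congr ?_ fun _ _ => rfl
      ext p
      simp only [Finset.mem_filter, Finset.mem_Ioc]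
      have := Nat.floor_le_floor hzx
      constructor
      · rintro ⟨⟨h1, h2⟩, h3⟩; exact ⟨⟨⟨h1, h2.trans this⟩, h3⟩, h2⟩
      · rintro ⟨⟨⟨h1, _⟩, h3⟩, h2⟩; exact ⟨⟨h1, h2⟩, h3⟩
    rw [hAz, hA, hS, Finset.sum_div, Finset.sum_div, ← Finset.sum_add_distrib]
    refine Finset.sum_le_sum fun p hp => ?_
    simp only [Finset.mem_filter, Finset.mem_Ioc] at hp
    have hp2 : (2 : ℝ) ≤ p := by exact_mod_cast hp.2.two_le
    have hpp : 0 ≤ (p : ℝ) ^ (-α) := by positivity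
    have hlogp : Real.log 2 ≤ Real.log p := Real.log_le_log two_pos hp2
    split_ifs with h
    · have h1 : (p : ℝ) ^ (-α) ≤ (p : ℝ) ^ (-α) * Real.log p / Real.log 2 := by
        rw [le_div_iff₀ hlog2]; exact mul_le_mul_of_nonneg_left hlogp hpp
      have h2 : 0 ≤ (p : ℝ) ^ (-α) * Real.log p / Real.log z :=
        div_nonneg (mul_nonneg hpp (hlog2.le.trans hlogp)) hlogz.le
      linarith
    · rw [zero_div, zero_add, le_div_iff₀ hlogz]
      refine mul_le_mul_of_nonneg_left (Real.log_le_log (by linarith) ?_) hpp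
      exact (Nat.lt_of_floor_lt (not_le.mp h)).le
  rw [Metric.tendsto_nhds]
  intro ε hε
  obtain ⟨δ, ⟨hδ1, hδ2⟩, hδ0⟩ : ∃ δ : ℝ, (1 / (1 - α) / (1 - δ) < 1 / (1 - α) + ε ∧ δ < 1) ∧ 0 < δ := by
    have h1 : Tendsto (fun δ : ℝ => 1 / (1 - α) / (1 - δ)) (𝓝[>] 0) (𝓝 (1 / (1 - α) / (1 - 0))) :=
      ((continuousAt_const.div (continuousAt_const.sub continuousAt_id) (by simp)).tendsto).mono_left
        nhdsWithin_le_nhds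
    rw [sub_zero, div_one] at h1
    have h2 : ∀ᶠ δ : ℝ in 𝓝[>] 0, δ < 1 := nhdsWithin_le_nhds (eventually_lt_nhds one_pos)
    exact (((h1.eventually_lt_const (by linarith)).and h2).and self_mem_nhdsWithin).exists
  have hz : Tendsto (fun x : ℝ => x ^ (1 - δ)) atTop atTop := tendsto_rpow_atTop (by linarith)
  have hlog : Tendsto (fun x : ℝ => Real.log x / x ^ (δ * (1 - α))) atTop (𝓝 0) :=
    (isLittleO_log_rpow_atTop (mul_pos hδ0 (by linarith))).tendsto_div_nhds_zero
  have hub := (((hAlim.comp hz).mul hlog).div_const (Real.log 2)).add (hAlim.div_const (1 - δ))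
  rw [mul_zero, zero_div, zero_add] at hub
  filter_upwards [hub.eventually_lt_const hδ1, hAlim.eventually_const_lt
    (show 1 / (1 - α) - ε < 1 / (1 - α) by linarith), eventually_gt_atTop 1] with x h1 h2 hx
  have hx0 : 0 < x := by linarith
  have hlogx := Real.log_pos hx
  have hxp := Real.rpow_pos_of_pos hx0 (1 - α)
  rw [Real.dist_eq, abs_lt]
  constructor
  · have := div_le_div_of_nonneg_right (hAS x hx0.le) hxp.le
    rw [mul_div_assoc] at this
    linarith
  · have h3 := hSz x (x ^ (1 - δ)) (Real.one_lt_rpow hx (by linarith)) (by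
      nth_rewrite 2 [← Real.rpow_one x]
      exact Real.rpow_le_rpow_of_exponent_le hx.le (by linarith))
    have h4 := mul_le_mul_of_nonneg_right h3 (div_pos hlogx hxp).le
    have e : (A (x ^ (1 - δ)) / Real.log 2 + A x / Real.log (x ^ (1 - δ))) *
        (Real.log x / x ^ (1 - α)) = ((fun x => A x / x ^ (1 - α)) ∘ fun x => x ^ (1 - δ)) x *
        (Real.log x / x ^ (δ * (1 - α))) / Real.log 2 + A x / x ^ (1 - α) / (1 - δ) := by
      rw [Real.log_rpow hx0, Function.comp_apply, ← Real.rpow_mul hx0.le]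
      have e1 : x ^ (1 - α) = x ^ ((1 - δ) * (1 - α)) * x ^ (δ * (1 - α)) := by
        rw [← Real.rpow_add hx0]; ring_nf
      have e2 := (Real.rpow_pos_of_pos hx0 ((1 - δ) * (1 - α))).ne'
      have e3 := (Real.rpow_pos_of_pos hx0 (δ * (1 - α))).ne'
      have e4 : 1 - δ ≠ 0 := by linarith
      rw [e1]
      field_simp
    rw [e] at h4
    linarith

/-! ### Divisor sums and their extremal primes -/

/-- The arithmetic function `n ↦ n ^ (-α)`. -/
noncomputable def rpowNegArith (α : ℝ) : ArithmeticFunction ℝ :=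
  ⟨fun n => if n = 0 then 0 else (n : ℝ) ^ (-α), by simp⟩

lemma rpowNegArith_apply (α : ℝ) {n : ℕ} (hn : n ≠ 0) : rpowNegArith α n = (n : ℝ) ^ (-α) :=
  if_neg hn

lemma isMultiplicative_rpowNegArith (α : ℝ) : (rpowNegArith α).IsMultiplicative := by
  refine ArithmeticFunction.IsMultiplicative.iff_ne_zero.mpr ⟨?_, fun {m n} hm hn _ => ?_⟩
  · rw [rpowNegArith_apply α one_ne_zero]; simp
  · rw [rpowNegArith_apply α hm, rpowNegArith_apply α hn, rpowNegArith_apply α (mul_ne_zero hm hn),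
      Nat.cast_mul, Real.mul_rpow (by positivity) (by positivity)]

lemma sum_divisors_rpowNegArith (α : ℝ) (n : ℕ) :
    ∑ d ∈ n.divisors, rpowNegArith α d = ∑ d ∈ n.divisors, (d : ℝ) ^ (-α) :=
  Finset.sum_congr rfl fun _ hd => rpowNegArith_apply α (Nat.pos_of_mem_divisors hd).ne'

lemma fracSigma_eq_rpow_mul_sum (α : ℝ) (n : ℕ) :
    fracSigma α n = (n : ℝ) ^ α * ∑ d ∈ n.divisors, (d : ℝ) ^ (-α) := by
  rw [fracSigma, ← Nat.sum_div_divisors n fun d => (d : ℝ) ^ α, Finset.mul_sum]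
  refine Finset.sum_congr rfl fun d hd => ?_
  rw [Nat.cast_div (Nat.dvd_of_mem_divisors hd)
    (by exact_mod_cast (Nat.pos_of_mem_divisors hd).ne'),
    Real.div_rpow (by positivity) (by positivity), Real.rpow_neg (by positivity), div_eq_mul_inv]

lemma rpow_neg_lt_one {α : ℝ} (hα : 0 < α) {p : ℕ} (hp : p.Prime) : (p : ℝ) ^ (-α) < 1 :=
  Real.rpow_lt_one_of_one_lt_of_neg (by exact_mod_cast hp.one_lt) (by linarith)

/-- Multiplicativity reduces this to prime powers, where a finite geometric sum is completed to the
infinite series. -/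
lemma sum_divisors_rpow_neg_le {α : ℝ} (hα : 0 < α) {n : ℕ} (hn : n ≠ 0) :
    ∑ d ∈ n.divisors, (d : ℝ) ^ (-α) ≤ ∏ p ∈ n.primeFactors, (1 - (p : ℝ) ^ (-α))⁻¹ := by
  have hmul : ((rpowNegArith α) * (ArithmeticFunction.zeta : ArithmeticFunction ℝ)).IsMultiplicative :=
    (isMultiplicative_rpowNegArith α).mul ArithmeticFunction.isMultiplicative_zeta.natCast
  have h := ArithmeticFunction.IsMultiplicative.multiplicative_factorization _ hmul hn
  simp only [ArithmeticFunction.coe_mul_zeta_apply, sum_divisors_rpowNegArith] at h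
  rw [h, Finsupp.prod, Nat.support_factorization]
  refine Finset.prod_le_prod (fun p _ => Finset.sum_nonneg fun _ _ => by positivity) fun p hp => ?_
  have hp' := Nat.prime_of_mem_primeFactors hp
  rw [Nat.sum_divisors_prime_pow hp']
  have e (k : ℕ) : ((p ^ k : ℕ) : ℝ) ^ (-α) = ((p : ℝ) ^ (-α)) ^ k := by
    rw [Nat.cast_pow, ← Real.rpow_natCast, ← Real.rpow_natCast, ← Real.rpow_mul (by positivity),
      ← Real.rpow_mul (by positivity), mul_comm]
  simp_rw [e]
  have hlt := rpow_neg_lt_one hα hp'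
  have h0 : 0 ≤ (p : ℝ) ^ (-α) := by positivity
  rw [← tsum_geometric_of_lt_one h0 hlt]
  exact (summable_geometric_of_lt_one h0 hlt).sum_le_tsum _ fun _ _ => by positivity

lemma sum_divisors_rpow_neg_of_squarefree (α : ℝ) {n : ℕ} (hn : Squarefree n) :
    ∑ d ∈ n.divisors, (d : ℝ) ^ (-α) = ∏ p ∈ n.primeFactors, (1 + (p : ℝ) ^ (-α)) := by
  rw [← sum_divisors_rpowNegArith,
    ← (isMultiplicative_rpowNegArith α).prodPrimeFactors_one_add_of_squarefree hn]
  exact Finset.prod_congr rfl fun p hp => by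
    rw [rpowNegArith_apply α (Nat.prime_of_mem_primeFactors hp).ne_zero]

lemma log_fracSigma_div_le {α : ℝ} (hα : 0 < α) {n : ℕ} {x : ℝ} (hn : n ≠ 0) (hx : (n : ℝ) ≤ x) :
    Real.log (fracSigma α n / x ^ α) ≤ ∑ p ∈ n.primeFactors, -Real.log (1 - (p : ℝ) ^ (-α)) := by
  have hn0 : (0 : ℝ) < n := by exact_mod_cast Nat.pos_of_ne_zero hn
  have hxα : 0 < x ^ α := Real.rpow_pos_of_pos (hn0.trans_le hx) α
  have hσ : 0 < fracSigma α n := Finset.sum_pos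
    (fun d hd => Real.rpow_pos_of_pos (by exact_mod_cast Nat.pos_of_mem_divisors hd) _)
    ⟨1, Nat.one_mem_divisors.mpr hn⟩
  have hfac {p : ℕ} (hp : p ∈ n.primeFactors) : 0 < 1 - (p : ℝ) ^ (-α) :=
    sub_pos.mpr (rpow_neg_lt_one hα (Nat.prime_of_mem_primeFactors hp))
  have h1 : fracSigma α n / x ^ α ≤ ∏ p ∈ n.primeFactors, (1 - (p : ℝ) ^ (-α))⁻¹ := by
    rw [div_le_iff₀ hxα, fracSigma_eq_rpow_mul_sum, mul_comm]
    exact mul_le_mul (sum_divisors_rpow_neg_le hα hn) (Real.rpow_le_rpow hn0.le hx hα.le)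
      (by positivity) (Finset.prod_nonneg fun p hp => (inv_pos.mpr (hfac hp)).le)
  refine (Real.log_le_log (div_pos hσ hxα) h1).trans_eq ?_
  rw [Real.log_prod fun p hp => (inv_pos.mpr (hfac hp)).ne']
  simp_rw [Real.log_inv]

/-- A Lagrange multiplier argument. With `c = L^(-α) / log L`, the quantity `p^(-α) - c log p` is
nonnegative for `p ≤ L` and nonpositive for `p ≥ L`, so its sum over any finite set of primes is
largest for all primes up to `L`. The constraint `∑ log p ≤ L` accounts for the term in `L - θ(L)`.
-/
lemma sum_primeFactors_rpow_neg_le {α : ℝ} (hα : 0 < α) {n : ℕ} (hn : n ≠ 0) {L : ℝ} (hL : 1 < L)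
    (hnL : Real.log n ≤ L) :
    ∑ p ∈ n.primeFactors, (p : ℝ) ^ (-α) ≤
      (∑ p ∈ Finset.Ioc 0 ⌊L⌋₊ with p.Prime, (p : ℝ) ^ (-α)) +
        L ^ (-α) / Real.log L * (L - Chebyshev.theta L) := by
  set c := L ^ (-α) / Real.log L with hc
  have hL0 : 0 < L := by linarith
  have hlogL := Real.log_pos hL
  have hc0 : 0 < c := div_pos (Real.rpow_pos_of_pos hL0 _) hlogL
  have hcL : c * Real.log L = L ^ (-α) := div_mul_cancel₀ _ hlogL.ne'
  have hlog : ∑ p ∈ n.primeFactors, Real.log p ≤ L := by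
    rw [← Real.log_prod fun p hp => by
      exact_mod_cast (Nat.prime_of_mem_primeFactors hp).ne_zero]
    refine (Real.log_le_log ?_ ?_).trans hnL
    · exact Finset.prod_pos fun p hp => by exact_mod_cast (Nat.prime_of_mem_primeFactors hp).pos
    · rw [← Nat.cast_prod]
      exact_mod_cast Nat.le_of_dvd (Nat.pos_of_ne_zero hn) (Nat.prod_primeFactors_dvd n)
  have hmain : ∑ p ∈ n.primeFactors, ((p : ℝ) ^ (-α) - c * Real.log p) ≤
      ∑ p ∈ Finset.Ioc 0 ⌊L⌋₊ with p.Prime, ((p : ℝ) ^ (-α) - c * Real.log p) := by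
    calc _ ≤ ∑ p ∈ n.primeFactors with p ≤ ⌊L⌋₊, ((p : ℝ) ^ (-α) - c * Real.log p) := by
          rw [Finset.sum_filter]
          refine Finset.sum_le_sum fun p hp => ?_
          split_ifs with h
          · exact le_rfl
          · have hpL : L ≤ p := (Nat.lt_of_floor_lt (not_le.mp h)).le
            have h1 : (p : ℝ) ^ (-α) ≤ L ^ (-α) :=
              Real.rpow_le_rpow_of_nonpos hL0 hpL (by linarith)
            have h2 := mul_le_mul_of_nonneg_left (Real.log_le_log hL0 hpL) hc0.le
            linarith
      _ ≤ _ := by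
          refine Finset.sum_le_sum_of_subset_of_nonneg (fun p hp => ?_) fun p hp _ => ?_
          · simp only [Finset.mem_filter, Finset.mem_Ioc] at hp ⊢
            have := Nat.prime_of_mem_primeFactors hp.1
            exact ⟨⟨this.pos, hp.2⟩, this⟩
          · simp only [Finset.mem_filter, Finset.mem_Ioc] at hp
            have hp0 : (0 : ℝ) < p := by exact_mod_cast hp.1.1
            have hpL : (p : ℝ) ≤ L := (Nat.le_floor_iff hL0.le).mp hp.1.2
            have h1 : L ^ (-α) ≤ (p : ℝ) ^ (-α) :=
              Real.rpow_le_rpow_of_nonpos hp0 hpL (by linarith)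
            have h2 := mul_le_mul_of_nonneg_left (Real.log_le_log hp0 hpL) hc0.le
            linarith
  rw [Finset.sum_sub_distrib, Finset.sum_sub_distrib, ← Finset.mul_sum, ← Finset.mul_sum,
    ← Chebyshev.theta] at hmain
  have := mul_le_mul_of_nonneg_left hlog hc0.le
  linarith

/-- The witness is the largest multiple of the primorial `P` not exceeding `x`. It is at least `x /
2`, and the divisors of the squarefree `P` already give the product. -/
lemma exists_fracSigma_ge {α : ℝ} (hα : 0 < α) {x y : ℝ} (hx : 0 < x)
    (hy : Chebyshev.theta y ≤ Real.log x) :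
    ∃ n : ℕ, 1 ≤ n ∧ (n : ℝ) ≤ x ∧
      (x / 2) ^ α * ∏ p ∈ Finset.Ioc 0 ⌊y⌋₊ with p.Prime, (1 + (p : ℝ) ^ (-α)) ≤ fracSigma α n := by
  set P := primorial ⌊y⌋₊ with hP
  have hP0 : (0 : ℝ) < P := by exact_mod_cast primorial_pos _
  have hPx : (P : ℝ) ≤ x := by
    rwa [Chebyshev.theta_eq_log_primorial, Real.log_le_log_iff hP0 hx] at hy
  have hr : 1 ≤ x / P := (one_le_div hP0).mpr hPx
  have hm1 : 1 ≤ ⌊x / P⌋₊ := Nat.one_le_floor_iff _ |>.mpr hr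
  have hPf : P.primeFactors = {p ∈ Finset.Ioc 0 ⌊y⌋₊ | p.Prime} := by
    rw [hP, primeFactors_primorial]
    ext p
    simp only [Nat.mem_primesLE, Finset.mem_filter, Finset.mem_Ioc]
    exact ⟨fun h => ⟨⟨h.2.pos, h.1⟩, h.2⟩, fun h => ⟨h.1.2, h.2⟩⟩
  have hsq : Squarefree P := by
    rw [hP, primorial]
    refine Finset.squarefree_prod_of_pairwise_isCoprime (fun p hp q hq hpq => ?_) fun p hp => ?_
    · simp only [Finset.coe_filter, Set.mem_ofPred_eq] at hp hq
      exact Nat.coprime_iff_isRelPrime.mp ((Nat.coprime_primes hp.2 hq.2).mpr hpq)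
    · exact (Finset.mem_filter.mp hp).2.prime.squarefree
  have hn0 : ⌊x / P⌋₊ * P ≠ 0 := mul_ne_zero (by omega) (primorial_ne_zero _)
  refine ⟨⌊x / P⌋₊ * P, Nat.one_le_iff_ne_zero.mpr hn0, ?_, ?_⟩
  · rw [Nat.cast_mul, ← le_div_iff₀ hP0]
    exact Nat.floor_le (by linarith)
  · rw [fracSigma_eq_rpow_mul_sum, ← hPf, ← sum_divisors_rpow_neg_of_squarefree α hsq]
    refine mul_le_mul (Real.rpow_le_rpow (by positivity) ?_ hα.le) ?_
      (Finset.sum_nonneg fun _ _ => by positivity) (by positivity)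
    -- For `r ≥ 1`, adding `⌊r⌋ ≥ 1` and `⌊r⌋ > r - 1` gives `⌊r⌋ > r / 2`.
    · have h1 : (1 : ℝ) ≤ (⌊x / P⌋₊ : ℝ) := by exact_mod_cast hm1
      have h2 := Nat.lt_floor_add_one (x / P)
      rw [Nat.cast_mul, ← div_le_iff₀ hP0, div_right_comm]
      linarith
    · exact Finset.sum_le_sum_of_subset_of_nonneg
        (Nat.divisors_subset_of_dvd hn0 (dvd_mul_left _ _)) fun _ _ _ => by positivity

/-! ### Asymptotics of the supremum -/

/-- The finitely many exceptions cost a constant independent of `s`; this uniformity allows `s` to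
be the prime factors of a varying `n`. -/
lemma exists_sum_le_add_sum {f F : ℕ → ℝ} (hf : ∀ n, 0 ≤ f n) (h : ∀ᶠ n in atTop, F n ≤ f n) :
    ∃ K, ∀ s : Finset ℕ, ∑ n ∈ s, F n ≤ K + ∑ n ∈ s, f n := by
  obtain ⟨N, hN⟩ := eventually_atTop.mp h
  refine ⟨∑ n ∈ Finset.range N, |F n|, fun s => ?_⟩
  have h1 : ∑ n ∈ s with n < N, |F n| ≤ ∑ n ∈ Finset.range N, |F n| :=
    Finset.sum_le_sum_of_subset_of_nonneg
      (fun n hn => Finset.mem_range.mpr (Finset.mem_filter.mp hn).2) fun _ _ _ => abs_nonneg _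
  refine le_trans ?_ (add_le_add_left h1 _)
  rw [Finset.sum_filter, ← Finset.sum_add_distrib]
  refine Finset.sum_le_sum fun n _ => ?_
  split_ifs with hn
  · linarith [le_abs_self (F n), hf n]
  · linarith [hN n (not_lt.mp hn)]

lemma tendsto_natCast_rpow_neg {α : ℝ} (hα : 0 < α) :
    Tendsto (fun n : ℕ => (n : ℝ) ^ (-α)) atTop (𝓝 0) :=
  (tendsto_rpow_neg_atTop hα).comp tendsto_natCast_atTop_atTop

lemma exists_sum_neg_log_one_sub_le {α : ℝ} (hα : 0 < α) {ε : ℝ} (hε : 0 < ε) :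
    ∃ K, ∀ s : Finset ℕ, ∑ p ∈ s, -Real.log (1 - (p : ℝ) ^ (-α)) ≤
      K + (1 + ε) * ∑ p ∈ s, (p : ℝ) ^ (-α) := by
  simp_rw [Finset.mul_sum]
  refine exists_sum_le_add_sum (fun n => by positivity) ?_
  filter_upwards [(tendsto_natCast_rpow_neg hα).eventually_lt_const
    (show 0 < ε / (1 + ε) by positivity)] with n hn
  have h0 : 0 ≤ (n : ℝ) ^ (-α) := by positivity
  set u := (n : ℝ) ^ (-α)
  rw [lt_div_iff₀ (by positivity)] at hn
  have hu : 0 < 1 - u := by nlinarith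
  have h1 := Real.one_sub_inv_le_log_of_pos hu
  have h2 : (1 - u)⁻¹ ≤ 1 + (1 + ε) * u := by
    rw [inv_le_iff_one_le_mul₀ hu]
    nlinarith
  linarith

lemma exists_mul_sum_le_sum_log_one_add {α : ℝ} (hα : 0 < α) {ε : ℝ} (hε : 0 < ε) :
    ∃ K, ∀ s : Finset ℕ, (1 - ε) * ∑ p ∈ s, (p : ℝ) ^ (-α) ≤
      K + ∑ p ∈ s, Real.log (1 + (p : ℝ) ^ (-α)) := by
  simp_rw [Finset.mul_sum]
  refine exists_sum_le_add_sum
    (fun n => Real.log_nonneg (le_add_of_nonneg_right (by positivity))) ?_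
  filter_upwards [(tendsto_natCast_rpow_neg hα).eventually_lt_const hε] with n hn
  have h0 : 0 ≤ (n : ℝ) ^ (-α) := by positivity
  set u := (n : ℝ) ^ (-α)
  have hu : 0 < 1 + u := by linarith
  have h1 := Real.one_sub_inv_le_log_of_pos hu
  have h2 : (1 + u)⁻¹ ≤ 1 - (1 - ε) * u := by
    rw [inv_le_iff_one_le_mul₀ hu]
    nlinarith [mul_nonneg h0 hε.le, mul_nonneg (mul_nonneg h0 h0) hε.le]
  linarith

lemma fracSigma_pos (α : ℝ) {n : ℕ} (hn : 1 ≤ n) : 0 < fracSigma α n :=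
  Finset.sum_pos (fun _ hd => Real.rpow_pos_of_pos (by exact_mod_cast Nat.pos_of_mem_divisors hd) _)
    ⟨1, Nat.one_mem_divisors.mpr (by omega)⟩

lemma one_le_fracSigma (α : ℝ) {n : ℕ} (hn : 1 ≤ n) : 1 ≤ fracSigma α n := by
  have := Finset.single_le_sum (f := fun d : ℕ => (d : ℝ) ^ α) (fun _ _ => by positivity)
    (Nat.one_mem_divisors.mpr (by omega : n ≠ 0))
  simpa [fracSigma] using this

lemma rpow_le_fracSigma (α : ℝ) {n : ℕ} (hn : 1 ≤ n) : (n : ℝ) ^ α ≤ fracSigma α n :=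
  Finset.single_le_sum (f := fun d : ℕ => (d : ℝ) ^ α) (fun _ _ => by positivity)
    (Nat.mem_divisors_self n (by omega))

lemma isGreatest_sSup_fracSigmaValues (α : ℝ) {x : ℝ} (hx : 1 ≤ x) :
    IsGreatest (fracSigmaValues α x) (sSup (fracSigmaValues α x)) := by
  have hfin : (fracSigmaValues α x).Finite := by
    refine ((Set.finite_Icc 1 ⌊x⌋₊).image (fracSigma α)).subset ?_
    rintro _ ⟨n, h1, h2, rfl⟩
    exact ⟨n, ⟨h1, Nat.le_floor h2⟩, rfl⟩
  have hne : (fracSigmaValues α x).Nonempty := ⟨_, 1, le_rfl, by simpa using hx, rfl⟩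
  exact ⟨hne.csSup_mem hfin, fun y hy => le_csSup hfin.bddAbove hy⟩

lemma tendsto_log_sSup_fracSigmaValues {α : ℝ} (hα0 : 0 < α) (hα1 : α < 1) :
    Tendsto (fun x : ℝ => Real.log (sSup (fracSigmaValues α x) / x ^ α) *
      (Real.log (Real.log x) / Real.log x ^ (1 - α))) atTop (𝓝 (1 / (1 - α))) := by
  have h1α : 0 < 1 - α := by linarith
  set S : ℝ → ℝ := fun y => ∑ p ∈ Finset.Ioc 0 ⌊y⌋₊ with p.Prime, (p : ℝ) ^ (-α) with hS
  set W : ℝ → ℝ := fun L => Real.log L / L ^ (1 - α) with hW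
  have hSW : Tendsto (fun y => S y * W y) atTop (𝓝 (1 / (1 - α))) :=
    tendsto_sum_primes_rpow hα0 hα1
  have hW0 : Tendsto W atTop (𝓝 0) := (isLittleO_log_rpow_atTop h1α).tendsto_div_nhds_zero
  have hθ := tendsto_theta_div_self
  rw [Metric.tendsto_nhds]
  intro η hη
  -- The two expressions are the limits of the upper and lower bounds below; `(1-ε)^(1-α)` arises
  -- from using only the primes up to `(1-ε) L`.
  obtain ⟨ε, ⟨⟨hε1, hε2⟩, hε3⟩, hε⟩ : ∃ ε : ℝ, (((1 + ε) * (1 / (1 - α)) < 1 / (1 - α) + η ∧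
      1 / (1 - α) - η < (1 - ε) * (1 / (1 - α) * (1 - ε) ^ (1 - α))) ∧ ε < 1) ∧ 0 < ε := by
    have h1 : Tendsto (fun ε : ℝ => (1 + ε) * (1 / (1 - α))) (𝓝[>] 0) (𝓝 ((1 + 0) * (1 / (1 - α)))) :=
      (Continuous.tendsto (by fun_prop) _).mono_left nhdsWithin_le_nhds
    have h2 : Tendsto (fun ε : ℝ => (1 - ε) * (1 / (1 - α) * (1 - ε) ^ (1 - α))) (𝓝[>] 0)
        (𝓝 ((1 - 0) * (1 / (1 - α) * (1 - 0) ^ (1 - α)))) := by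
      refine Tendsto.mono_left (ContinuousAt.tendsto ?_) nhdsWithin_le_nhds
      have : ContinuousAt (fun ε : ℝ => 1 - ε) 0 := by fun_prop
      exact this.mul (continuousAt_const.mul (this.rpow_const (Or.inl (by simp))))
    simp only [add_zero, one_mul, sub_zero, Real.one_rpow, mul_one] at h1 h2
    have h3 : ∀ᶠ ε : ℝ in 𝓝[>] 0, ε < 1 := nhdsWithin_le_nhds (eventually_lt_nhds one_pos)
    exact ((((h1.eventually_lt_const (by linarith)).and (h2.eventually_const_lt (by linarith))).and
      h3).and self_mem_nhdsWithin).exists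
  obtain ⟨K₁, hK₁⟩ := exists_sum_neg_log_one_sub_le hα0 hε
  obtain ⟨K₂, hK₂⟩ := exists_mul_sum_le_sum_log_one_add hα0 hε
  have hup : Tendsto (fun L => K₁ * W L + (1 + ε) * (S L * W L + (1 - Chebyshev.theta L / L)))
      atTop (𝓝 ((1 + ε) * (1 / (1 - α)))) := by
    have := (hW0.const_mul K₁).add ((hSW.add (hθ.const_sub 1)).const_mul (1 + ε))
    simpa using this
  have h1ε : 0 < 1 - ε := by linarith
  have hyt : Tendsto (fun L : ℝ => (1 - ε) * L) atTop atTop := tendsto_id.const_mul_atTop h1ε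
  have hlo : Tendsto (fun L => (-(α * Real.log 2) - K₂) * W L + (1 - ε) * (S ((1 - ε) * L) * W L))
      atTop (𝓝 ((1 - ε) * (1 / (1 - α) * (1 - ε) ^ (1 - α)))) := by
    have hratio : Tendsto (fun L => Real.log L / Real.log ((1 - ε) * L)) atTop (𝓝 1) := by
      have h1 : Tendsto (fun L => (Real.log (1 - ε) / Real.log L + 1)⁻¹) atTop (𝓝 (0 + 1)⁻¹) :=
        (((tendsto_const_nhds).div_atTop Real.tendsto_log_atTop).add_const 1).inv₀ (by simp)
      rw [zero_add, inv_one] at h1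
      refine h1.congr' ?_
      filter_upwards [eventually_gt_atTop 1] with L hL
      have := (Real.log_pos hL).ne'
      rw [Real.log_mul h1ε.ne' (by linarith), div_add_one this, inv_div]
    have hSWL : Tendsto (fun L => S ((1 - ε) * L) * W L) atTop
        (𝓝 (1 / (1 - α) * (1 - ε) ^ (1 - α))) := by
      have := ((hSW.comp hyt).mul hratio).mul_const ((1 - ε) ^ (1 - α))
      rw [mul_one] at this
      refine this.congr' ?_
      filter_upwards [eventually_gt_atTop 0, hyt.eventually_gt_atTop 1] with L hL hL2
      have h2 := (Real.log_pos hL2).ne'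
      have h3 := (Real.rpow_pos_of_pos hL (1 - α)).ne'
      have h4 := (Real.rpow_pos_of_pos h1ε (1 - α)).ne'
      simp only [Function.comp_apply, hW]
      rw [Real.mul_rpow h1ε.le hL.le]
      field_simp
    have := (hW0.const_mul (-(α * Real.log 2) - K₂)).add (hSWL.const_mul (1 - ε))
    simpa using this
  -- Shortening to `(1-ε) L` ensures that the primorial fits below `x = exp L`.
  have hθy : ∀ᶠ L : ℝ in atTop, Chebyshev.theta ((1 - ε) * L) ≤ L := by
    have h1 : (1 : ℝ) < 1 / (1 - ε) := by rw [lt_div_iff₀ h1ε]; linarith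
    filter_upwards [(hθ.comp hyt).eventually_lt_const h1, eventually_gt_atTop 0] with L hL hL0
    rw [Function.comp_apply, div_lt_div_iff₀ (by positivity) h1ε] at hL
    nlinarith
  have hlog := Real.tendsto_log_atTop
  filter_upwards [hlog.eventually (hup.eventually_lt_const hε1),
    hlog.eventually (hlo.eventually_const_lt hε2), hlog.eventually hθy,
    hlog.eventually (eventually_gt_atTop 1), eventually_ge_atTop 1] with x hx1 hx2 hx3 hx4 hx5
  have hx0 : 0 < x := by linarith
  set L := Real.log x with hL
  have hL0 : 0 < L := by linarith
  have hlogL := Real.log_pos hx4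
  have hWpos : 0 < W L := div_pos hlogL (Real.rpow_pos_of_pos hL0 _)
  have hxα := Real.rpow_pos_of_pos hx0 α
  obtain ⟨⟨n, hn1, hnx, hn⟩, hmax⟩ := isGreatest_sSup_fracSigmaValues α hx5
  rw [Real.dist_eq, abs_lt]
  constructor
  · obtain ⟨m, hm1, hmx, hm⟩ := exists_fracSigma_ge hα0 hx0 hx3
    have hmM : fracSigma α m ≤ sSup (fracSigmaValues α x) := hmax ⟨m, hm1, hmx, rfl⟩
    have hprod : 0 < ∏ p ∈ Finset.Ioc 0 ⌊(1 - ε) * L⌋₊ with p.Prime, (1 + (p : ℝ) ^ (-α)) :=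
      Finset.prod_pos fun p _ => by positivity
    have h1 : 2⁻¹ ^ α * ∏ p ∈ Finset.Ioc 0 ⌊(1 - ε) * L⌋₊ with p.Prime, (1 + (p : ℝ) ^ (-α)) ≤
        sSup (fracSigmaValues α x) / x ^ α := by
      rw [le_div_iff₀ hxα]
      refine le_trans (le_of_eq ?_) (hm.trans hmM)
      rw [div_eq_mul_inv, Real.mul_rpow hx0.le (by norm_num)]
      ring
    have h2 := Real.log_le_log (by positivity) h1
    rw [Real.log_mul (by positivity) hprod.ne', Real.log_rpow (by norm_num), Real.log_inv,
      Real.log_prod fun p _ => by positivity] at h2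
    have h3 := hK₂ {p ∈ Finset.Ioc 0 ⌊(1 - ε) * L⌋₊ | p.Prime}
    have h4 : (-(α * Real.log 2) - K₂) + (1 - ε) * S ((1 - ε) * L) ≤
        Real.log (sSup (fracSigmaValues α x) / x ^ α) := by
      simp only [hS]
      linarith
    have h5 := mul_le_mul_of_nonneg_right h4 hWpos.le
    rw [add_mul, mul_assoc (1 - ε)] at h5
    linarith
  · have h1 := log_fracSigma_div_le hα0 (by omega : n ≠ 0) hnx
    rw [← hn] at h1
    have h2 := hK₁ n.primeFactors
    have h3 := sum_primeFactors_rpow_neg_le hα0 (by omega : n ≠ 0) hx4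
      (Real.log_le_log (by exact_mod_cast hn1) hnx)
    have h4 : Real.log (sSup (fracSigmaValues α x) / x ^ α) ≤
        K₁ + (1 + ε) * (S L + L ^ (-α) / Real.log L * (L - Chebyshev.theta L)) :=
      h1.trans (h2.trans (add_le_add_right (mul_le_mul_of_nonneg_left h3 (by linarith)) _))
    have h5 := mul_le_mul_of_nonneg_right h4 hWpos.le
    have e : L ^ (-α) / Real.log L * (L - Chebyshev.theta L) * W L =
        1 - Chebyshev.theta L / L := by
      simp only [hW]
      rw [Real.rpow_neg hL0.le, Real.rpow_sub hL0, Real.rpow_one]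
      have := (Real.rpow_pos_of_pos hL0 α).ne'
      field_simp
    rw [add_mul K₁, mul_assoc (1 + ε), add_mul (S L), e] at h5
    linarith

/-! ### The Ω-result and the conclusion -/

/-- Since `σ_α(n) ≥ n^α` is unbounded, some `n` exceeds the maximum over `[1, Y]`; the least such
`n` is a record. -/
lemma exists_record (α : ℝ) (hα : 0 < α) (X : ℝ) :
    ∃ n : ℕ, 2 ≤ n ∧ X < n ∧ ∀ m : ℕ, 1 ≤ m → m ≤ n → fracSigma α m ≤ fracSigma α n := by
  set Y := max X 1
  have hY : 1 ≤ Y := le_max_right _ _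
  have hg := isGreatest_sSup_fracSigmaValues α hY
  have hex : ∃ n : ℕ, 1 ≤ n ∧ sSup (fracSigmaValues α Y) < fracSigma α n := by
    have h := ((tendsto_rpow_atTop hα).comp tendsto_natCast_atTop_atTop).eventually_gt_atTop
      (sSup (fracSigmaValues α Y))
    obtain ⟨n, hn, hn1⟩ := (h.and (eventually_ge_atTop 1)).exists
    exact ⟨n, hn1, hn.trans_le (rpow_le_fracSigma α hn1)⟩
  classical
  have hspec := Nat.find_spec hex
  have hmin := fun m => Nat.find_min (m := m) hex
  set n := Nat.find hex
  have hYn : Y < n := by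
    by_contra! h
    exact absurd (hg.2 ⟨n, hspec.1, h, rfl⟩) (not_le.mpr hspec.2)
  refine ⟨n, ?_, (le_max_left _ _).trans_lt hYn, fun m hm1 hmn => ?_⟩
  · have : (1 : ℝ) < n := hY.trans_lt hYn
    exact_mod_cast this
  · rcases hmn.eq_or_lt with rfl | hlt
    · exact le_rfl
    · have := hmin m hlt
      push Not at this
      exact (this hm1).trans hspec.2.le

lemma isOmega_sSup_fracSigmaValues {α : ℝ} (hα0 : 0 < α) :
    IsOmega (sigmaError α) (fun x => sSup (fracSigmaValues α x)) := by
  refine ⟨1 / 4, by norm_num, frequently_atTop.mpr fun X => ?_⟩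
  -- Starting from `X + 1` keeps the left neighbour `n - d` above `X` too.
  obtain ⟨n, hn2, hXn, hrec⟩ := exists_record α hα0 (X + 1)
  have hn2' : (2 : ℝ) ≤ n := by exact_mod_cast hn2
  have hσ := one_le_fracSigma α (by omega : 1 ≤ n)
  set main : ℝ → ℝ := fun x => x ^ (1 + α) / (1 + α) * (riemannZeta ((1 + α : ℝ) : ℂ)).re
    + x * (riemannZeta ((1 - α : ℝ) : ℂ)).re with hmain
  have hcont : ContinuousAt main n := by
    have : ContinuousAt (fun x : ℝ => x ^ (1 + α)) n :=
      Real.continuousAt_rpow_const _ _ (Or.inr (by linarith))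
    fun_prop
  obtain ⟨δ, hδ, hball⟩ := Metric.continuousAt_iff.mp hcont (1 / 2) (by norm_num)
  -- The bound `1/2` makes `n - 1` the floor of `n - d`; the bound `δ/2` keeps the main term's
  -- change below `1/2`, hence below `σ_α(n) / 2`.
  set d := min (δ / 2) (1 / 2) with hd
  have hd0 : 0 < d := lt_min (by linarith) (by norm_num)
  have hd1 : d ≤ 1 / 2 := min_le_right _ _
  have hclose := hball (x := n - d) (by
    rw [Real.dist_eq, sub_sub_cancel_left, abs_neg, abs_of_pos hd0]
    linarith [min_le_left (δ / 2) (1 / 2)])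
  rw [Real.dist_eq] at hclose
  have hfloor : ⌊(n : ℝ) - d⌋₊ = n - 1 := by
    rw [Nat.floor_eq_iff (by linarith), Nat.cast_sub (by omega), Nat.cast_one]
    constructor <;> linarith
  have hjump : sigmaError α n - sigmaError α (n - d) = fracSigma α n - (main n - main (n - d)) := by
    have hsum : ∑ k ∈ Finset.Icc 1 n, fracSigma α k =
        ∑ k ∈ Finset.Icc 1 (n - 1), fracSigma α k + fracSigma α n := by
      obtain ⟨k, rfl⟩ : ∃ k, n = k + 1 := ⟨n - 1, by omega⟩
      rw [Finset.sum_Icc_succ_top (by omega), Nat.add_sub_cancel]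
    rw [sigmaError, sigmaError, Nat.floor_natCast, hfloor, hsum]
    ring
  have hMle {x : ℝ} (hx1 : 1 ≤ x) (hxn : x ≤ n) :
      |sSup (fracSigmaValues α x)| ≤ fracSigma α n := by
    obtain ⟨m, hm1, hmx, hm⟩ := (isGreatest_sSup_fracSigmaValues α hx1).1
    rw [hm, abs_of_pos (fracSigma_pos α hm1)]
    exact hrec m hm1 (by exact_mod_cast hmx.trans hxn)
  have habs : fracSigma α n / 2 ≤ |sigmaError α n| + |sigmaError α (n - d)| := by
    have h1 := abs_sub (sigmaError α n) (sigmaError α (n - d))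
    rw [hjump] at h1
    have h2 := le_abs_self (fracSigma α n - (main n - main (n - d)))
    have h3 := (abs_lt.mp hclose).1
    linarith
  by_cases h : fracSigma α n / 4 ≤ |sigmaError α n|
  · exact ⟨n, by linarith, by linarith [hMle (by linarith : (1 : ℝ) ≤ n) le_rfl]⟩
  · exact ⟨n - d, by linarith, by
      linarith [hMle (by linarith : 1 ≤ (n : ℝ) - d) (by linarith), not_le.mp h]⟩

theorem mainTheorem4 (α : ℝ) (hα0 : 0 < α) (hα1 : α < 1) :
    ∃ η : ℝ → ℝ, Tendsto η atTop (𝓝 0) ∧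
      (∀ᶠ x : ℝ in atTop, IsLUB (fracSigmaValues α x) (sigmaMaxOrder α (η x) x)) ∧
      IsOmega (sigmaError α) (fun x => sigmaMaxOrder α (η x) x) := by
  -- Here `η` is obtained by solving `G(x) = sup` for the exponent, which is possible once `log log
  -- x > 0`; what remains to be shown is `η → 0` and the Ω-bound for the supremum itself.
  set η : ℝ → ℝ := fun x => Real.log (sSup (fracSigmaValues α x) / x ^ α) *
    (Real.log (Real.log x) / Real.log x ^ (1 - α)) - 1 / (1 - α) with hη
  have hEq : ∀ᶠ x : ℝ in atTop, 1 ≤ x ∧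
      sigmaMaxOrder α (η x) x = sSup (fracSigmaValues α x) := by
    filter_upwards [Real.tendsto_log_atTop.eventually (eventually_gt_atTop 1),
      eventually_ge_atTop 1] with x hx hx1
    refine ⟨hx1, ?_⟩
    have hxα : 0 < x ^ α := Real.rpow_pos_of_pos (by linarith) α
    obtain ⟨m, hm1, -, hm⟩ := (isGreatest_sSup_fracSigmaValues α hx1).1
    have hM : 0 < sSup (fracSigmaValues α x) := hm ▸ fracSigma_pos α hm1
    have h1 := (Real.log_pos hx).ne'
    have h2 := (Real.rpow_pos_of_pos (by linarith : 0 < Real.log x) (1 - α)).ne'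
    have e : (1 / (1 - α) + η x) * (Real.log x ^ (1 - α) / Real.log (Real.log x)) =
        Real.log (sSup (fracSigmaValues α x) / x ^ α) := by
      rw [hη, add_sub_cancel, mul_assoc, div_mul_div_cancel₀ h2, div_self h1, mul_one]
    rw [sigmaMaxOrder, e, Real.exp_log (div_pos hM hxα), mul_div_cancel₀ _ hxα.ne']
  refine ⟨η, ?_, ?_, ?_⟩
  · have h := (tendsto_log_sSup_fracSigmaValues hα0 hα1).sub_const (1 / (1 - α))
    rwa [sub_self] at h
  · filter_upwards [hEq] with x hx
    rw [hx.2]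
    exact (isGreatest_sSup_fracSigmaValues α hx.1).isLUB
  · obtain ⟨c, hc, hfreq⟩ := isOmega_sSup_fracSigmaValues hα0
    exact ⟨c, hc, (hfreq.and_eventually hEq).mono fun x hx => by
      simp only [hx.2.2]; exact hx.1⟩
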